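/- All graphs are finite and simple, and a class of graphs is a collection of graphs closed under isomorphism. For a graph $G$ with vertex set $V$ and adjacency matrix $\mathrm{Adj}(G)$, let $\mathcal O(\mathrm{Qu}(G))$ (the algebra of coefficients of the quantum automorphism group $\mathrm{Qu}(G)$) be the universal unital complex $*$-algebra generated by elements $p_{xy}$, $x,y\in V$, with the relations $p_{xy}^*=p_{xy}=p_{xy}^2$, $\sum_{z}p_{xz}=1=\sum_z p_{zy}$, $p_{xy}p_{xz}=\delta_{yz}\,p_{xy}$, $p_{xy}p_{zy}=\delta_{xz}\,p_{xy}$ and $\mathrm{Adj}(G)\,p=p\,\mathrm{Adj}(G)$. One says that $\mathrm{Qu}(G)$ is trivial if $\mathcal O(\mathrm{Qu}(G))=\mathbb C$, and that $G$ has quantum symmetry if $\mathcal O(\mathrm{Qu}(G))$ is not commutative. The graph $G$ satisfies Schmidt's criterion if it has two nontrivial automorphisms with disjoint supports. Two graphs $G$ and $H$ with the same number of vertices are quantum isomorphic if there are a nonzero unital $C^*$-algebra $X$ and a matrix $P$ with coefficients in $X$, with rows indexed by $V(H)$ and columns by $V(G)$, whose coefficients are self-adjoint projections summing to $1$ on every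 row and every column (and hence pairwise orthogonal within each row and each column), such that $P\,\mathrm{Adj}(G)=\mathrm{Adj}(H)\,P$. For a class of graphs $\mathcal F$ consider the axioms - (QA) for all $G\in\mathcal F$, $\mathrm{Qu}(G)$ is trivial if and only if $\mathrm{Aut}(G)$ is trivial; - (QI) for all $G,H\in\mathcal F$, $G$ and $H$ are quantum isomorphic if and only if they are isomorphic; - (SA) for all $G\in\mathcal F$, $G$ has quantum symmetry if and only if $G$ satisfies Schmidt's criterion. Let $\mathrm{co}(\mathcal F)$ be the smallest class of graphs that contains $\mathcal F$ and is stable under taking sums (disjoint unions) and complements. **Theorem.** Let $\mathcal F$ be a class of graphs that is stable under taking complements and connected components. Then: 1. if $\mathcal F$ satisfies (QI), so does $\mathrm{co}(\mathcal F)$; 2. if $\mathcal F$ satisfies (QI) and (QA), so does $\mathrm{co}(\mathcal F)$; 3. if $\mathcal F$ satisfies (QI), (QA) and (SA), so does $\mathrm{co}(\mathcal F)$. -/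

import Mathlib

noncomputable section

/-! ### Finite graphs and graph classes -/

/-- A finite simple graph. -/
structure FinGraph where
  V : Type
  [fintype : Fintype V]
  graph : SimpleGraph V

namespace FinGraph

attribute [instance] FinGraph.fintype

/-- Two graphs are isomorphic. -/
def Iso (G H : FinGraph) : Prop := Nonempty (G.graph ≃g H.graph)

/-- The complement of a graph. -/
def compl (G : FinGraph) : FinGraph := ⟨G.V, G.graphᶜ⟩

/-- The sum (disjoint union) of two graphs. -/
def sum (G H : FinGraph) : FinGraph := ⟨G.V ⊕ H.V, G.graph ⊕g H.graph⟩

/-- A connected component of a graph, as a graph. -/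
def component (G : FinGraph) (C : G.graph.ConnectedComponent) : FinGraph :=
  letI : Fintype C := Fintype.ofFinite C
  ⟨C, C.toSimpleGraph⟩

open scoped Classical in
/-- The adjacency matrix of a graph, with coefficients in a ring `A`. -/
def adj (G : FinGraph) (A : Type*) [Ring A] : Matrix G.V G.V A := G.graph.adjMatrix A

/-- The automorphism group of `G` is trivial. -/
def TrivialAut (G : FinGraph) : Prop := Subsingleton (G.graph ≃g G.graph)

/-- Schmidt's criterion: there are two nontrivial automorphisms with disjoint supports. -/
def SchmidtCriterion (G : FinGraph) : Prop :=
  ∃ f g : G.graph ≃g G.graph, (∃ x, f x ≠ x) ∧ (∃ x, g x ≠ x) ∧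
    Disjoint {x | f x ≠ x} {x | g x ≠ x}

end FinGraph

/-- A class of graphs: a collection of finite graphs, considered up to isomorphism. -/
structure GraphClass where
  carrier : Set FinGraph
  iso_mem : ∀ {G H : FinGraph}, G.Iso H → G ∈ carrier → H ∈ carrier

instance : Membership FinGraph GraphClass := ⟨fun F G => G ∈ F.carrier⟩

/-! ### Universal `*`-algebras -/

/-- The unital ring of (noncommutative, complex) `*`-polynomials in variables indexed by `ι`: the
free unital algebra on the letters `(i, false)`, standing for `x i`, and `(i, true)`, standing
for `(x i)*`. -/
def StarPoly (ι : Type*) : Type _ := FreeAlgebra ℂ (ι × Bool)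

namespace StarPoly

variable {ι : Type*}

instance : Ring (StarPoly ι) := inferInstanceAs (Ring (FreeAlgebra ℂ (ι × Bool)))
instance : Algebra ℂ (StarPoly ι) := inferInstanceAs (Algebra ℂ (FreeAlgebra ℂ (ι × Bool)))

/-- A letter of the free algebra. -/
def letter (x : ι × Bool) : StarPoly ι := FreeAlgebra.ι ℂ x

/-- The variable `x i`. -/
def X (i : ι) : StarPoly ι := letter (i, false)

/-- Universal property of the free algebra on the letters. -/
def liftLetters {B : Type*} [Ring B] [Algebra ℂ B] (f : ι × Bool → B) : StarPoly ι →ₐ[ℂ] B :=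
  FreeAlgebra.lift ℂ f

theorem liftLetters_letter {B : Type*} [Ring B] [Algebra ℂ B] (f : ι × Bool → B)
    (x : ι × Bool) : liftLetters f (letter x) = f x :=
  FreeAlgebra.lift_ι_apply f x

theorem letters_induction {p : StarPoly ι → Prop} (h1 : ∀ c : ℂ, p (algebraMap ℂ _ c))
    (h2 : ∀ x, p (letter x)) (h3 : ∀ a b, p a → p b → p (a * b))
    (h4 : ∀ a b, p a → p b → p (a + b)) (a : StarPoly ι) : p a :=
  FreeAlgebra.induction (R := ℂ) (X := ι × Bool) (motive := p) h1 h2 h3 h4 a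

/-- The involution, as a ring morphism to the opposite ring: it conjugates scalars, reverses
products, and exchanges `x i` and `(x i)*`. -/
def starHom (ι : Type*) : StarPoly ι →+* (StarPoly ι)ᵐᵒᵖ :=
  letI : Algebra ℂ (StarPoly ι)ᵐᵒᵖ := Algebra.compHom (StarPoly ι)ᵐᵒᵖ (starRingEnd ℂ)
  (liftLetters (B := (StarPoly ι)ᵐᵒᵖ)
    (fun x => MulOpposite.op (letter (x.1, !x.2)))).toRingHom

theorem starHom_letter (x : ι × Bool) :
    starHom ι (letter x) = MulOpposite.op (letter (x.1, !x.2)) := by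
  let _ : Algebra ℂ (StarPoly ι)ᵐᵒᵖ := Algebra.compHom (StarPoly ι)ᵐᵒᵖ (starRingEnd ℂ)
  exact liftLetters_letter (B := (StarPoly ι)ᵐᵒᵖ) _ x

theorem starHom_algebraMap (c : ℂ) :
    starHom ι (algebraMap ℂ _ c) = MulOpposite.op (algebraMap ℂ _ (star c)) := by
  let _ : Algebra ℂ (StarPoly ι)ᵐᵒᵖ := Algebra.compHom (StarPoly ι)ᵐᵒᵖ (starRingEnd ℂ)
  exact (liftLetters (B := (StarPoly ι)ᵐᵒᵖ)
    (fun x => MulOpposite.op (letter (x.1, !x.2)))).commutes c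

instance : StarRing (StarPoly ι) where
  star a := (starHom ι a).unop
  star_involutive a := by
    induction a using letters_induction with
    | h1 c => simp [starHom_algebraMap]
    | h2 x => simp [starHom_letter]
    | h3 a b ha hb => simp only [map_mul, MulOpposite.unop_mul, ha, hb]
    | h4 a b ha hb => simp only [map_add, MulOpposite.unop_add, ha, hb]
  star_mul a b := by simp only [map_mul, MulOpposite.unop_mul]
  star_add a b := by simp only [map_add, MulOpposite.unop_add]

theorem star_letter (x : ι × Bool) : star (letter x : StarPoly ι) = letter (x.1, !x.2) :=
  congrArg MulOpposite.unop (starHom_letter x)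

theorem star_algebraMap (c : ℂ) :
    star (algebraMap ℂ (StarPoly ι) c) = algebraMap ℂ _ (star c) :=
  congrArg MulOpposite.unop (starHom_algebraMap c)

instance : StarModule ℂ (StarPoly ι) where
  star_smul c a := by
    rw [Algebra.smul_def, star_mul, star_algebraMap, ← Algebra.commutes, ← Algebra.smul_def]

/-- Evaluation of `*`-polynomials at a family of elements of a unital `*`-algebra. -/
def eval {B : Type*} [Ring B] [StarRing B] [Algebra ℂ B] [StarModule ℂ B] (b : ι → B) :
    StarPoly ι →⋆ₐ[ℂ] B :=
  { liftLetters (fun x : ι × Bool => if x.2 then star (b x.1) else b x.1) with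
    map_star' := by
      intro a
      change liftLetters _ (star a) = star (liftLetters _ a)
      induction a using letters_induction with
      | h1 c => rw [star_algebraMap, AlgHom.commutes, AlgHom.commutes, algebraMap_star_comm]
      | h2 x =>
        rw [star_letter, liftLetters_letter, liftLetters_letter]
        rcases x with ⟨i, _ | _⟩ <;> simp
      | h3 a b ha hb => simp only [star_mul, map_mul, ha, hb]
      | h4 a b ha hb => simp only [star_add, map_add, ha, hb] }

theorem eval_X {B : Type*} [Ring B] [StarRing B] [Algebra ℂ B] [StarModule ℂ B] (b : ι → B)
    (i : ι) : eval b (X i) = b i := by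
  change liftLetters _ (letter (i, false)) = b i
  rw [liftLetters_letter]
  simp

end StarPoly

/-- `R` generates a `*`-ideal: each relator is set to `0`, and so is its adjoint. -/
def starRel {ι : Type*} (R : Set (StarPoly ι)) (a b : StarPoly ι) : Prop :=
  (a ∈ R ∨ star a ∈ R) ∧ b = 0

/-- The universal unital `*`-algebra generated by variables indexed by `ι` and relations `R`. -/
def UnivStarAlg {ι : Type*} (R : Set (StarPoly ι)) : Type _ := RingQuot (starRel R)

namespace UnivStarAlg

variable {ι : Type*} (R : Set (StarPoly ι))

instance : Ring (UnivStarAlg R) := inferInstanceAs (Ring (RingQuot (starRel R)))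
instance : Algebra ℂ (UnivStarAlg R) := inferInstanceAs (Algebra ℂ (RingQuot (starRel R)))

theorem starRel_star (a b : StarPoly ι) (h : starRel R a b) : starRel R (star a) (star b) := by
  obtain ⟨h1, rfl⟩ := h
  refine ⟨?_, star_zero _⟩
  rw [star_star]
  exact h1.symm

instance : StarRing (UnivStarAlg R) := RingQuot.starRing (starRel R) (starRel_star R)

/-- The quotient map. -/
def mk : StarPoly ι →ₐ[ℂ] UnivStarAlg R := RingQuot.mkAlgHom ℂ (starRel R)

theorem mk_surjective : Function.Surjective (mk R) := RingQuot.mkAlgHom_surjective ℂ (starRel R)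

theorem mk_star (a : StarPoly ι) : mk R (star a) = star (mk R a) := by
  simp only [mk, RingQuot.mkAlgHom_def, RingQuot.mkRingHom_def]
  rfl

instance : StarModule ℂ (UnivStarAlg R) where
  star_smul c a := by
    obtain ⟨a, rfl⟩ := mk_surjective R a
    rw [← map_smul, ← mk_star, star_smul, map_smul, mk_star]

/-- The generators. -/
def gen (i : ι) : UnivStarAlg R := mk R (StarPoly.X i)

theorem mk_eq_zero {a : StarPoly ι} (h : a ∈ R) : mk R a = 0 := by
  have := RingQuot.mkAlgHom_rel ℂ (s := starRel R) (x := a) (y := 0) ⟨Or.inl h, rfl⟩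
  exact this.trans (map_zero (mk R))

/-- Universal property: a family satisfying the relations defines a unital `*`-morphism. -/
theorem exists_lift {B : Type*} [Ring B] [StarRing B] [Algebra ℂ B] [StarModule ℂ B] (b : ι → B)
    (hb : ∀ a ∈ R, StarPoly.eval b a = 0) :
    ∃ φ : UnivStarAlg R →⋆ₐ[ℂ] B, ∀ i, φ (gen R i) = b i := by
  have hrel : ∀ ⦃x y⦄, starRel R x y →
      (StarPoly.eval b).toAlgHom x = (StarPoly.eval b).toAlgHom y := by
    rintro x y ⟨h | h, rfl⟩
    · exact (hb x h).trans (map_zero (StarPoly.eval b)).symm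
    · have h2 : star (StarPoly.eval b x) = 0 := by
        rw [← map_star]
        exact hb _ h
      exact (star_eq_zero.mp h2).trans (map_zero (StarPoly.eval b)).symm
  let φ : UnivStarAlg R →ₐ[ℂ] B :=
    RingQuot.liftAlgHom ℂ ⟨(StarPoly.eval b).toAlgHom, hrel⟩
  have hφ : ∀ a, φ (mk R a) = StarPoly.eval b a := fun a =>
    RingQuot.liftAlgHom_mkAlgHom_apply ℂ _ hrel a
  refine ⟨{ φ with map_star' := ?_ }, fun i => ?_⟩
  · intro a
    obtain ⟨a, rfl⟩ := mk_surjective R a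
    change φ (star (mk R a)) = star (φ (mk R a))
    rw [← mk_star, hφ, hφ, map_star]
  · exact (hφ _).trans (StarPoly.eval_X b i)

end UnivStarAlg

/-! ### The quantum automorphism group of a graph -/

section Relations

variable (V : Type) [Fintype V]

/-- The matrix of variables. -/
def varMatrix (V : Type) : Matrix V V (StarPoly (V × V)) :=
  Matrix.of fun i j => StarPoly.X (i, j)

/-- The coefficients are self-adjoint and idempotent. -/
def relP0 (V : Type) : Set (StarPoly (V × V)) :=
  {a | ∃ i j, a = star (varMatrix V i j) - varMatrix V i j} ∪
  {a | ∃ i j, a = varMatrix V i j ^ 2 - varMatrix V i j}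

/-- The rows and the columns sum to one. -/
def relP1 : Set (StarPoly (V × V)) :=
  {a | ∃ i, a = ∑ j, varMatrix V i j - 1} ∪ {a | ∃ j, a = ∑ i, varMatrix V i j - 1}

open scoped Classical in
/-- Distinct coefficients of a same row, or of a same column, are orthogonal. -/
def relP2 (V : Type) : Set (StarPoly (V × V)) :=
  {a | ∃ i j k, a = varMatrix V i j * varMatrix V i k - if j = k then varMatrix V i j else 0} ∪
  {a | ∃ i j k, a = varMatrix V i j * varMatrix V k j - if i = k then varMatrix V i j else 0}

/-- The defining relations of the quantum permutation group of the set `V`. -/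
def relPs : Set (StarPoly (V × V)) := relP0 V ∪ relP1 V ∪ relP2 V

end Relations

namespace FinGraph

/-- The coefficients of the commutator of the adjacency matrix and the matrix of variables. -/
def relAdj (G : FinGraph) : Set (StarPoly (G.V × G.V)) :=
  {a | ∃ i j, a = (G.adj (StarPoly (G.V × G.V)) * varMatrix G.V -
    varMatrix G.V * G.adj (StarPoly (G.V × G.V))) i j}

/-- The algebra of coefficients `O(Qu(G))` of the quantum automorphism group of `G`. -/
abbrev OQu (G : FinGraph) : Type := UnivStarAlg (relPs G.V ∪ G.relAdj)

/-- The quantum automorphism group of `G` is the trivial quantum group, whose algebra of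
coefficients is `ℂ`. -/
def TrivialQu (G : FinGraph) : Prop := Function.Bijective (algebraMap ℂ G.OQu)

/-- The graph `G` has quantum symmetry: `O(Qu(G))` is not commutative. -/
def QuantumSymmetry (G : FinGraph) : Prop := ¬ ∀ a b : G.OQu, a * b = b * a

end FinGraph

/-! ### Quantum isomorphism -/

/-- Magic unitaries, for matrices whose rows and columns are labelled by two finite sets. -/
structure IsMagicUnitary {I J A : Type*} [Fintype I] [Fintype J] [Ring A] [StarRing A]
    (U : Matrix I J A) : Prop where
  card_eq : Fintype.card I = Fintype.card J
  star_eq : ∀ i j, star (U i j) = U i j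
  idem : ∀ i j, U i j ^ 2 = U i j
  row_sum : ∀ i, ∑ j, U i j = 1
  col_sum : ∀ j, ∑ i, U i j = 1
  row_orth : ∀ i j k, j ≠ k → U i j * U i k = 0
  col_orth : ∀ i k j, i ≠ k → U i j * U k j = 0

/-- The graph `G` is quantum isomorphic to `H`: there is a magic unitary `P` with coefficients in
a nonzero unital C*-algebra such that `P Adj(G) = Adj(H) P`. -/
def FinGraph.QuantumIso (G H : FinGraph) : Prop :=
  ∃ (X : Type) (_ : CStarAlgebra X) (_ : Nontrivial X) (P : Matrix H.V G.V X),
    IsMagicUnitary P ∧ P * G.adj X = H.adj X * P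

/-! ### Axioms on graph classes, and `F`-cographs -/

namespace GraphClass

/-- The class is stable by taking complements. -/
def StableCompl (F : GraphClass) : Prop := ∀ G ∈ F, G.compl ∈ F

/-- The class is stable by taking sums. -/
def StableSum (F : GraphClass) : Prop := ∀ G ∈ F, ∀ H ∈ F, G.sum H ∈ F

/-- The class is stable by taking connected components. -/
def StableComponents (F : GraphClass) : Prop :=
  ∀ G ∈ F, ∀ C : G.graph.ConnectedComponent, G.component C ∈ F

/-- Quantum asymmetry. -/
def QA (F : GraphClass) : Prop := ∀ G ∈ F, G.TrivialQu ↔ G.TrivialAut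

/-- Quantum isomorphism. -/
def QI (F : GraphClass) : Prop := ∀ G ∈ F, ∀ H ∈ F, G.QuantumIso H ↔ G.Iso H

/-- Schmidt alternative. -/
def SA (F : GraphClass) : Prop := ∀ G ∈ F, G.QuantumSymmetry ↔ G.SchmidtCriterion

/-- Membership in the class of `F`-cographs. -/
inductive InCo (F : GraphClass) : FinGraph → Prop
  | base {G : FinGraph} : G ∈ F → InCo F G
  | sum {G H : FinGraph} : InCo F G → InCo F H → InCo F (G.sum H)
  | compl {G : FinGraph} : InCo F G → InCo F G.compl
  | iso {G H : FinGraph} : G.Iso H → InCo F G → InCo F H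

/-- The class `co(F)` of `F`-cographs. -/
def co (F : GraphClass) : GraphClass := ⟨{G | InCo F G}, InCo.iso⟩

/-- `co(F)` is the smallest class that contains `F` and is stable by sums and complements. -/
theorem co_isSmallest (F : GraphClass) :
    (∀ G ∈ F, G ∈ F.co) ∧ F.co.StableSum ∧ F.co.StableCompl ∧
      ∀ K : GraphClass, (∀ G ∈ F, G ∈ K) → K.StableSum → K.StableCompl → ∀ G ∈ F.co, G ∈ K := by
  refine ⟨fun G h => .base h, fun G hG H hH => .sum hG hH, fun G hG => .compl hG, ?_⟩
  intro K h1 h2 h3 G hG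
  induction hG with
  | base h => exact h1 _ h
  | sum _ _ ih ih' => exact h2 _ ih _ ih'
  | compl _ ih => exact h3 _ ih
  | iso e _ ih => exact K.iso_mem e ih

end GraphClass

end

/-! Everything rests on how a magic matrix `u` intertwining two graphs sees their connected
components. A product `u y x * u y' x'` vanishes unless `x`, `x'` are connected exactly when `y`,
`y'` are. Hence the sum of `u y x` over `y` in a component `D` depends only on the component `C` of
`x`; these idempotents `block G H u D C` form a magic matrix indexed by components. In the corner
cut out by a nonzero block, the entries of `u` between `C` and `D` form a magic matrix intertwining
`C` and `D`.

The induction is on the number of vertices. An F-cograph lies in `F`, or it or its complement is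
disconnected, with strictly smaller components that are again F-cographs. Magic matrices and all the
properties involved pass to complements, so only a disconnected graph has to be treated.

(QI): nonzero blocks join quantum isomorphic components, which are isomorphic by induction; a
trace-like count of the block matrix then matches the components of the two graphs
(`exists_equiv_of_label`).

(QA): an asymmetric graph has asymmetric, pairwise nonisomorphic components, which are rigid by
induction. A nonzero block at a rigid component comes from a genuine isomorphism
(`exists_iso_of_quantumRigid`), so off-diagonal blocks vanish.

(SA): if Schmidt's criterion fails on a disconnected graph, there are two cases. Either the
components are pairwise nonisomorphic and at most one has a nontrivial automorphism, or all are
asymmetric and no two disjoint pairs of isomorphic components exist. In the second case every entry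
of `u` is `0` or a block, and blocks commute by the argument that shows that the quantum permutation
group of three points is classical. Conversely, two disjointly supported automorphisms, each mixed
with the identity along an idempotent, give noncommuting entries. -/

noncomputable section

/-! ### Magic unitaries intertwining two graphs, over an arbitrary ring -/

/-- A magic matrix `u` over a ring, with rows indexed by the vertices of `H` and columns by the
vertices of `G`, that intertwines the two graphs. -/
structure GraphMagic {V W B : Type*} [Fintype V] [Fintype W] [Ring B] (G : SimpleGraph V)
    (H : SimpleGraph W) (u : W → V → B) : Prop where
  row_sum : ∀ y, ∑ x, u y x = 1
  col_sum : ∀ x, ∑ y, u y x = 1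
  row_orth : ∀ y x x', x ≠ x' → u y x * u y x' = 0
  col_orth : ∀ x y y', y ≠ y' → u y x * u y' x = 0
  adj_orth : ∀ x x' y y', ¬ (G.Adj x x' ↔ H.Adj y y') → u y x * u y' x' = 0

namespace GraphMagic

variable {V W B : Type*} [Fintype V] [Fintype W] [Ring B] {G : SimpleGraph V}
  {H : SimpleGraph W} {u : W → V → B}

theorem symm (hu : GraphMagic G H u) : GraphMagic H G (fun x y => u y x) where
  row_sum := hu.col_sum
  col_sum := hu.row_sum
  row_orth := hu.col_orth
  col_orth := hu.row_orth
  adj_orth x x' y y' h := hu.adj_orth y y' x x' fun h' => h h'.symm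

/-- Complementation changes adjacency only between distinct vertices; pairs with exactly one
equality are handled by row and column orthogonality. -/
theorem compl (hu : GraphMagic G H u) : GraphMagic Gᶜ Hᶜ u where
  row_sum := hu.row_sum
  col_sum := hu.col_sum
  row_orth := hu.row_orth
  col_orth := hu.col_orth
  adj_orth x x' y y' h := by
    by_cases hx : x = x'
    · subst hx
      by_cases hy : y = y'
      · subst hy
        simp at h
      · exact hu.col_orth _ _ _ hy
    · by_cases hy : y = y'
      · subst hy
        exact hu.row_orth _ _ _ hx
      · refine hu.adj_orth _ _ _ _ fun h' => h ?_
        simp [SimpleGraph.compl_adj, hx, hy, h']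

theorem idem (hu : GraphMagic G H u) (y : W) (x : V) : u y x * u y x = u y x := by
  conv_rhs => rw [← mul_one (u y x), ← hu.row_sum y, Finset.mul_sum]
  rw [Finset.sum_eq_single x (fun x' _ h => hu.row_orth _ _ _ h.symm) (by simp)]

theorem card_eq [Nontrivial B] [Algebra ℂ B] (hu : GraphMagic G H u) :
    Fintype.card V = Fintype.card W := by
  have h1 : ∑ y, ∑ x, u y x = (Fintype.card W : B) := by simp [hu.row_sum]
  have h2 : ∑ y, ∑ x, u y x = (Fintype.card V : B) := by
    rw [Finset.sum_comm]; simp [hu.col_sum]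
  have := algebraRat.charZero ℂ
  have : CharZero B := charZero_of_injective_algebraMap (algebraMap ℂ B).injective
  exact_mod_cast h2.symm.trans h1

/-- The magic matrix of an isomorphism. -/
theorem ofIso [DecidableEq W] (f : G ≃g H) :
    GraphMagic G H (fun y x => if y = f x then (1 : B) else 0) where
  row_sum y := by
    rw [Finset.sum_eq_single (f.symm y)] <;> simp +contextual [RelIso.eq_symm_apply, eq_comm]
  col_sum x := by simp
  row_orth y x x' h := by
    rw [ite_zero_mul_ite_zero, if_neg]
    exact fun h' => h (f.injective (h'.1.symm.trans h'.2))
  col_orth x y y' h := by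
    rw [ite_zero_mul_ite_zero, if_neg]
    exact fun h' => h (h'.1.trans h'.2.symm)
  adj_orth x x' y y' h := by
    rw [ite_zero_mul_ite_zero, if_neg]
    exact fun h' => h (by rw [h'.1, h'.2, f.map_adj_iff])

section AdjMatrix

variable [DecidableRel G.Adj] [DecidableRel H.Adj]

/-- Both entries at `(y, x')` equal the sum of `u y x * u y' x'` over the pairs `(x, y')` with `x`
adjacent to `x'` and `y` adjacent to `y'`. -/
theorem mul_adjMatrix (hu : GraphMagic G H u) :
    (Matrix.of u) * G.adjMatrix B = H.adjMatrix B * (Matrix.of u) := by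
  ext y x'
  have h1 : ∀ x, u y x * (if G.Adj x x' then (1 : B) else 0) =
      ∑ y', if G.Adj x x' ∧ H.Adj y y' then u y x * u y' x' else 0 := by
    intro x
    by_cases h : G.Adj x x'
    · simp only [h, if_true, true_and]
      rw [← hu.col_sum x', Finset.mul_sum]
      refine Finset.sum_congr rfl fun y' _ => ?_
      split_ifs with h'
      · rfl
      · exact hu.adj_orth _ _ _ _ (by tauto)
    · simp [h]
  have h2 : ∀ y', (if H.Adj y y' then (1 : B) else 0) * u y' x' =
      ∑ x, if G.Adj x x' ∧ H.Adj y y' then u y x * u y' x' else 0 := by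
    intro y'
    by_cases h : H.Adj y y'
    · simp only [h, if_true, and_true]
      rw [← hu.row_sum y, Finset.sum_mul]
      refine Finset.sum_congr rfl fun x _ => ?_
      split_ifs with h'
      · rfl
      · exact hu.adj_orth _ _ _ _ (by tauto)
    · simp [h]
  simp only [Matrix.mul_apply, Matrix.of_apply, SimpleGraph.adjMatrix_apply, h1, h2]
  exact Finset.sum_comm

/-- Sandwiching the matrix identity between `u y x` and `u y' x'` isolates a single term on each
side, present exactly when the corresponding pair is adjacent. -/
theorem of_mul_adjMatrix
    (row_sum : ∀ y, ∑ x, u y x = 1) (col_sum : ∀ x, ∑ y, u y x = 1)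
    (row_orth : ∀ y x x', x ≠ x' → u y x * u y x' = 0)
    (col_orth : ∀ x y y', y ≠ y' → u y x * u y' x = 0)
    (h : (Matrix.of u) * G.adjMatrix B = H.adjMatrix B * (Matrix.of u)) : GraphMagic G H u where
  row_sum := row_sum
  col_sum := col_sum
  row_orth := row_orth
  col_orth := col_orth
  adj_orth x x' y y' hxy := by
    have hr : ∀ y x, u y x * u y x = u y x := by
      intro y x
      conv_rhs => rw [← mul_one (u y x), ← row_sum y, Finset.mul_sum]
      rw [Finset.sum_eq_single x (fun x' _ h => row_orth _ _ _ h.symm) (by simp)]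
    have h1 : u y x * ((Matrix.of u) * G.adjMatrix B) y x' * u y' x' =
        (if G.Adj x x' then u y x * u y' x' else 0) := by
      simp only [Matrix.mul_apply, Matrix.of_apply, SimpleGraph.adjMatrix_apply]
      rw [Finset.mul_sum, Finset.sum_eq_single x]
      · rw [← mul_assoc, hr]
        split_ifs <;> simp
      · intro z _ hz
        rw [← mul_assoc, row_orth _ _ _ hz.symm, zero_mul]
      · simp
    have h2 : u y x * (H.adjMatrix B * (Matrix.of u)) y x' * u y' x' =
        (if H.Adj y y' then u y x * u y' x' else 0) := by
      simp only [Matrix.mul_apply, Matrix.of_apply, SimpleGraph.adjMatrix_apply]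
      rw [mul_assoc, Finset.sum_mul, Finset.sum_eq_single y']
      · rw [mul_assoc, hr]
        split_ifs <;> simp
      · intro z _ hz
        rw [mul_assoc, col_orth _ _ _ hz, mul_zero]
      · simp
    rw [h, h2] at h1
    by_cases h3 : G.Adj x x' <;> by_cases h4 : H.Adj y y' <;> simp_all

end AdjMatrix

/-! ### The connected components -/

/-- Inserting a full column sum at the second vertex of the walk splits the product: rows not
adjacent to `y` die by `adj_orth`, and adjacent rows are covered by the shorter walk. -/
theorem reachable_orth_aux (hu : GraphMagic G H u) {x x' : V} (p : G.Walk x x') :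
    ∀ y y', ¬ H.Reachable y y' → u y x * u y' x' = 0 := by
  induction p with
  | nil =>
    intro y y' h
    exact hu.col_orth _ _ _ fun e => h (e ▸ SimpleGraph.Reachable.refl _)
  | @cons a b c hab p ih =>
    intro y y' h
    rw [← mul_one (u y a), ← hu.col_sum b, Finset.mul_sum, Finset.sum_mul]
    refine Finset.sum_eq_zero fun w _ => ?_
    by_cases hw : H.Adj y w
    · rw [mul_assoc, ih _ _ fun h' => h (hw.reachable.trans h'), mul_zero]
    · rw [hu.adj_orth _ _ _ _ fun h' => hw (h'.1 hab), zero_mul]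

theorem reachable_orth (hu : GraphMagic G H u) {x x' : V} {y y' : W}
    (h : ¬ (G.Reachable x x' ↔ H.Reachable y y')) : u y x * u y' x' = 0 := by
  by_cases hx : G.Reachable x x'
  · obtain ⟨p⟩ := hx
    exact hu.reachable_orth_aux p _ _ fun h' => h ⟨fun _ => h', fun _ => ⟨p⟩⟩
  · by_cases hy : H.Reachable y y'
    · obtain ⟨p⟩ := hy
      exact hu.symm.reachable_orth_aux p _ _ hx
    · exact absurd ⟨fun h => absurd h hx, fun h => absurd h hy⟩ h

theorem component_orth (hu : GraphMagic G H u) {x x' : V} {y y' : W}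
    (h : ¬ (G.connectedComponentMk x = G.connectedComponentMk x' ↔
      H.connectedComponentMk y = H.connectedComponentMk y')) : u y x * u y' x' = 0 :=
  hu.reachable_orth (by simpa only [SimpleGraph.ConnectedComponent.eq] using h)

open scoped Classical in
/-- The block sum of the magic matrix at a column, along the component `D`. -/
def colBlock (H : SimpleGraph W) (u : W → V → B) (D : H.ConnectedComponent) (x : V) : B :=
  ∑ y with H.connectedComponentMk y = D, u y x

theorem colBlock_mul_self (hu : GraphMagic G H u) (x : V) (y : W) :
    colBlock H u (H.connectedComponentMk y) x * u y x = u y x := by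
  rw [colBlock, Finset.sum_mul, Finset.sum_eq_single y, hu.idem]
  · exact fun z _ hz => hu.col_orth _ _ _ hz
  · simp

theorem mul_colBlock_self (hu : GraphMagic G H u) (x : V) (y : W) :
    u y x * colBlock H u (H.connectedComponentMk y) x = u y x := by
  rw [colBlock, Finset.mul_sum, Finset.sum_eq_single y, hu.idem]
  · exact fun z _ hz => hu.col_orth _ _ _ hz.symm
  · simp

/-- Both block sums equal their product: inserting the full column sum at the other vertex, only the
rows in `D` survive. -/
theorem colBlock_congr (hu : GraphMagic G H u) (D : H.ConnectedComponent) {x x' : V}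
    (h : G.connectedComponentMk x = G.connectedComponentMk x') :
    colBlock H u D x = colBlock H u D x' := by
  classical
  have h1 : colBlock H u D x = colBlock H u D x * colBlock H u D x' := by
    conv_lhs => rw [colBlock]
    conv_rhs => rw [colBlock, Finset.sum_mul]
    refine Finset.sum_congr rfl fun y hy => ?_
    rw [Finset.mem_filter] at hy
    conv_lhs => rw [← mul_one (u y x), ← hu.col_sum x', Finset.mul_sum]
    rw [colBlock, Finset.mul_sum, Finset.sum_filter]
    refine Finset.sum_congr rfl fun y' _ => ?_
    split_ifs with h'
    · rfl
    · exact hu.component_orth fun h2 => h' ((h2.1 h).symm.trans hy.2)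
  have h2 : colBlock H u D x' = colBlock H u D x * colBlock H u D x' := by
    conv_lhs => rw [colBlock]
    conv_rhs => rw [colBlock.eq_1 H u D x', Finset.mul_sum]
    refine Finset.sum_congr rfl fun y hy => ?_
    rw [Finset.mem_filter] at hy
    conv_lhs => rw [← one_mul (u y x'), ← hu.col_sum x, Finset.sum_mul]
    rw [colBlock, Finset.sum_mul, Finset.sum_filter]
    refine Finset.sum_congr rfl fun y' _ => ?_
    split_ifs with h'
    · rfl
    · exact hu.component_orth fun h2 => h' ((h2.1 h).trans hy.2)
  exact h1.trans h2.symm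

/-- The column sum absorbs every term of the row sum on the left, and the row sum absorbs every term
of the column sum on the right, so their product equals both. This makes the block matrix symmetric
in the roles of rows and columns. -/
theorem colBlock_eq_rowBlock (hu : GraphMagic G H u) (x : V) (y : W) :
    colBlock H u (H.connectedComponentMk y) x =
      colBlock G (fun x y => u y x) (G.connectedComponentMk x) y := by
  classical
  set S := colBlock H u (H.connectedComponentMk y) x with hS
  set T := colBlock G (fun x y => u y x) (G.connectedComponentMk x) y with hT
  have h1 : S * T = T := by
    conv_rhs => rw [hT, colBlock]
    conv_lhs => rw [hT, colBlock, Finset.mul_sum]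
    refine Finset.sum_congr rfl fun x' hx' => ?_
    rw [Finset.mem_filter] at hx'
    rw [hS, ← hu.colBlock_congr _ hx'.2, hu.colBlock_mul_self]
  have h2 : S * T = S := by
    conv_rhs => rw [hS, colBlock]
    conv_lhs => rw [hS, colBlock, Finset.sum_mul]
    refine Finset.sum_congr rfl fun y' hy' => ?_
    rw [Finset.mem_filter] at hy'
    rw [hT, ← hu.symm.colBlock_congr _ hy'.2, hu.symm.mul_colBlock_self]
  exact h2.symm.trans h1

/-- The coefficients of the magic matrix of the components. -/
def block (G : SimpleGraph V) (H : SimpleGraph W) (u : W → V → B)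
    (D : H.ConnectedComponent) (C : G.ConnectedComponent) : B :=
  colBlock H u D C.out

theorem mk_out {V : Type*} {G : SimpleGraph V} (C : G.ConnectedComponent) :
    G.connectedComponentMk C.out = C := C.out_eq

theorem block_mk_right (hu : GraphMagic G H u) (D : H.ConnectedComponent) (x : V) :
    block G H u D (G.connectedComponentMk x) = colBlock H u D x :=
  hu.colBlock_congr _ (mk_out _)

theorem block_mk_left (hu : GraphMagic G H u) (C : G.ConnectedComponent) (y : W) :
    block G H u (H.connectedComponentMk y) C = colBlock G (fun x y => u y x) C y := by
  rw [block, hu.colBlock_eq_rowBlock, mk_out]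

theorem block_symm (hu : GraphMagic G H u) (D : H.ConnectedComponent) (C : G.ConnectedComponent) :
    block H G (fun x y => u y x) C D = block G H u D C := by
  rw [block, ← hu.block_mk_left, mk_out]

theorem block_mul (hu : GraphMagic G H u) (x : V) (y : W) :
    block G H u (H.connectedComponentMk y) (G.connectedComponentMk x) * u y x = u y x := by
  rw [hu.block_mk_right, hu.colBlock_mul_self]

theorem mul_block (hu : GraphMagic G H u) (x : V) (y : W) :
    u y x * block G H u (H.connectedComponentMk y) (G.connectedComponentMk x) = u y x := by
  rw [hu.block_mk_right, hu.mul_colBlock_self]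

instance {G : SimpleGraph V} (C : G.ConnectedComponent) : Fintype C := Fintype.ofFinite C

instance (G : SimpleGraph V) : Fintype G.ConnectedComponent := Fintype.ofFinite _

theorem sum_block (hu : GraphMagic G H u) (C : G.ConnectedComponent) :
    ∑ D, block G H u D C = 1 := by
  classical
  simp only [block, colBlock]
  rw [← hu.col_sum C.out]
  exact Finset.sum_fiberwise _ _ _

theorem block_mul_block (hu : GraphMagic G H u) (C : G.ConnectedComponent)
    {D D' : H.ConnectedComponent} (h : D ≠ D') : block G H u D C * block G H u D' C = 0 := by
  classical
  simp only [block, colBlock]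
  rw [Finset.sum_mul]
  refine Finset.sum_eq_zero fun y hy => ?_
  rw [Finset.mul_sum]
  refine Finset.sum_eq_zero fun y' hy' => hu.col_orth _ _ _ ?_
  rw [Finset.mem_filter] at hy hy'
  rintro rfl
  exact h (hy.2.symm.trans hy'.2)

theorem block_graphMagic (hu : GraphMagic G H u) :
    GraphMagic (⊥ : SimpleGraph G.ConnectedComponent) (⊥ : SimpleGraph H.ConnectedComponent)
      (block G H u) where
  row_sum D := by simpa only [hu.block_symm] using hu.symm.sum_block D
  col_sum := hu.sum_block
  row_orth D C C' h := by simpa only [hu.block_symm] using hu.symm.block_mul_block D h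
  col_orth C _ _ h := hu.block_mul_block C h
  adj_orth _ _ _ _ h := by simp at h

end GraphMagic

/-! ### Corners -/

namespace Corner

variable {B : Type*} [Ring B] {e : B} (he : IsIdempotentElem e)

/-- The inclusion of a corner. -/
def val : he.Corner →ₙ+* B where
  toFun a := a.1
  map_mul' _ _ := rfl
  map_zero' := rfl
  map_add' _ _ := rfl

theorem val_injective : Function.Injective (val he) := Subtype.val_injective

theorem val_one : val he 1 = e := rfl

theorem mul_val (a : he.Corner) : e * val he a = val he a :=
  ((Subsemigroup.mem_corner_iff he).mp a.2).1

theorem val_mul (a : he.Corner) : val he a * e = val he a :=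
  ((Subsemigroup.mem_corner_iff he).mp a.2).2

/-- The element of the corner given by an element absorbed by the idempotent. -/
def ofMem (a : B) (h : e * a = a) (h' : a * e = a) : he.Corner :=
  ⟨a, (Subsemigroup.mem_corner_iff he).mpr ⟨h, h'⟩⟩

theorem nontrivial (h : e ≠ 0) : Nontrivial he.Corner :=
  ⟨1, 0, fun h' => h (congrArg (val he) h')⟩

section Algebra

variable [Algebra ℂ B]

instance : SMul ℂ he.Corner :=
  ⟨fun c a => ofMem he (c • val he a) (by rw [mul_smul_comm, mul_val])
    (by rw [smul_mul_assoc, val_mul])⟩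

theorem val_smul (c : ℂ) (a : he.Corner) : val he (c • a) = c • val he a := rfl

instance : Module ℂ he.Corner :=
  Function.Injective.module ℂ (val he).toAddMonoidHom (val_injective he) (val_smul he)

instance : Algebra ℂ he.Corner :=
  Algebra.ofModule
    (fun c a b => val_injective he (smul_mul_assoc c (val he a) (val he b)))
    (fun c a b => val_injective he (mul_smul_comm c (val he a) (val he b)))

end Algebra

/-- The corner of a C*-algebra at a projection is a C*-algebra. -/
@[reducible] def cstarAlgebra {X : Type*} [CStarAlgebra X] {e : X} (he : IsIdempotentElem e)
    (hs : star e = e) : CStarAlgebra he.Corner :=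
  letI : NormedRing he.Corner := NormedRing.induced he.Corner X (val he) (val_injective he)
  letI : StarRing he.Corner :=
    { star := fun a => ofMem he (star (val he a))
        (by simpa only [star_mul, hs] using congrArg star (val_mul he a))
        (by simpa only [star_mul, hs] using congrArg star (mul_val he a))
      star_involutive := fun a => val_injective he (star_star (val he a))
      star_mul := fun a b => val_injective he (star_mul (val he a) (val he b))
      star_add := fun a b => val_injective he (star_add (val he a) (val he b)) }
  { norm_smul_le := fun c a => norm_smul_le c (val he a)
    star_smul := fun c a => val_injective he (star_smul c (val he a))
    norm_mul_self_le := fun a => CStarRing.norm_mul_self_le (val he a)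
    -- The corner is the closed subspace of `X` cut out by `e * a = a` and `a * e = a`.
    toCompleteSpace := by
      have hi : Isometry (val he) := fun _ _ => rfl
      have hr : Set.range (val he) = {a | e * a = a ∧ a * e = a} := by
        ext a
        exact ⟨by rintro ⟨a, rfl⟩; exact ⟨mul_val he a, val_mul he a⟩,
          fun h => ⟨ofMem he a h.1 h.2, rfl⟩⟩
      have hc : IsClosed (Set.range (val he)) := by
        rw [hr]
        exact (isClosed_eq (by fun_prop) continuous_id).inter
          (isClosed_eq (by fun_prop) continuous_id)
      exact (completeSpace_iff_isComplete_range hi.isUniformInducing).mpr hc.isComplete }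

end Corner

/-! ### Restricting a magic matrix to a pair of components -/

namespace GraphMagic

variable {V W B : Type*} [Fintype V] [Fintype W] [Ring B] {G : SimpleGraph V}
  {H : SimpleGraph W} {u : W → V → B}

theorem block_idem (hu : GraphMagic G H u) (D : H.ConnectedComponent)
    (C : G.ConnectedComponent) : IsIdempotentElem (block G H u D C) :=
  hu.block_graphMagic.idem D C

/-- The coefficients of the magic matrix at two components, in the corner of the block. -/
def cornerBlock (hu : GraphMagic G H u) (D : H.ConnectedComponent) (C : G.ConnectedComponent)
    (y : D) (x : C) : (hu.block_idem D C).Corner :=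
  Corner.ofMem _ (u y x)
    (by have := hu.block_mul x y; rwa [show H.connectedComponentMk y = D from y.2,
          show G.connectedComponentMk x = C from x.2] at this)
    (by have := hu.mul_block x y; rwa [show H.connectedComponentMk y = D from y.2,
          show G.connectedComponentMk x = C from x.2] at this)

theorem val_cornerBlock (hu : GraphMagic G H u) (D : H.ConnectedComponent)
    (C : G.ConnectedComponent) (y : D) (x : C) :
    Corner.val _ (hu.cornerBlock D C y x) = u y x := rfl

theorem sum_component_eq_block (hu : GraphMagic G H u) (D : H.ConnectedComponent)
    (C : G.ConnectedComponent) (x : C) : ∑ y : D, u y x = block G H u D C := by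
  classical
  obtain ⟨x, rfl⟩ := x
  rw [hu.block_mk_right, colBlock]
  exact (Finset.sum_subtype _ (fun y => by simp; rfl) (fun y => u y x)).symm

theorem sum_component_eq_block' (hu : GraphMagic G H u) (D : H.ConnectedComponent)
    (C : G.ConnectedComponent) (y : D) : ∑ x : C, u y x = block G H u D C := by
  rw [← hu.block_symm]
  exact hu.symm.sum_component_eq_block C D y

/-- Rows and columns restricted to the two components sum to the block, which is the unit of the
corner. -/
theorem cornerBlock_graphMagic (hu : GraphMagic G H u) (D : H.ConnectedComponent)
    (C : G.ConnectedComponent) :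
    GraphMagic C.toSimpleGraph D.toSimpleGraph (hu.cornerBlock D C) where
  row_sum y := Corner.val_injective _ (by
    simp only [map_sum, val_cornerBlock, Corner.val_one, hu.sum_component_eq_block'])
  col_sum x := Corner.val_injective _ (by
    simp only [map_sum, val_cornerBlock, Corner.val_one, hu.sum_component_eq_block])
  row_orth y x x' h := Corner.val_injective _ (by
    simpa only [map_mul, val_cornerBlock, map_zero] using
      hu.row_orth _ _ _ (Subtype.coe_injective.ne h))
  col_orth y x x' h := Corner.val_injective _ (by
    simpa only [map_mul, val_cornerBlock, map_zero] using
      hu.col_orth _ _ _ (Subtype.coe_injective.ne h))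
  adj_orth x x' y y' h := Corner.val_injective _ (by
    simpa only [map_mul, val_cornerBlock, map_zero] using
      hu.adj_orth (x : V) x' (y : W) y' h)

/-- When the block is `1`, the matrix of coefficients at two components is magic. -/
theorem of_block_eq_one (hu : GraphMagic G H u) {D : H.ConnectedComponent}
    {C : G.ConnectedComponent} (h : block G H u D C = 1) :
    GraphMagic C.toSimpleGraph D.toSimpleGraph (fun y x => u y x) where
  row_sum y := by rw [hu.sum_component_eq_block', h]
  col_sum x := by rw [hu.sum_component_eq_block, h]
  row_orth y x x' h := hu.row_orth _ _ _ (Subtype.coe_injective.ne h)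
  col_orth y x x' h := hu.col_orth _ _ _ (Subtype.coe_injective.ne h)
  adj_orth x x' y y' h := hu.adj_orth _ _ _ _ h

end GraphMagic

/-! ### Quantum isomorphism -/

namespace FinGraph

theorem quantumIso_iff (G H : FinGraph) :
    G.QuantumIso H ↔ ∃ (X : Type) (_ : CStarAlgebra X) (_ : Nontrivial X) (P : H.V → G.V → X),
      GraphMagic G.graph H.graph P ∧ ∀ y x, star (P y x) = P y x := by
  classical
  constructor
  · rintro ⟨X, _, _, P, h1, h2⟩
    exact ⟨X, _, ‹_›, P, GraphMagic.of_mul_adjMatrix h1.row_sum h1.col_sum h1.row_orth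
      (fun x y y' => h1.col_orth y y' x) h2, h1.star_eq⟩
  · rintro ⟨X, _, _, P, h1, h2⟩
    exact ⟨X, _, ‹_›, Matrix.of P, ⟨h1.card_eq.symm, h2, fun y x => by
      rw [pow_two]; exact h1.idem y x, h1.row_sum, h1.col_sum, h1.row_orth,
      fun y y' x => h1.col_orth x y y'⟩, h1.mul_adjMatrix⟩

theorem Iso.quantumIso {G H : FinGraph} (h : G.Iso H) : G.QuantumIso H := by
  classical
  obtain ⟨f⟩ := h
  refine (quantumIso_iff G H).2 ⟨ℂ, inferInstance, inferInstance, _, GraphMagic.ofIso f, ?_⟩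
  intro y x
  split_ifs <;> simp

theorem QuantumIso.compl {G H : FinGraph} (h : G.QuantumIso H) :
    G.compl.QuantumIso H.compl := by
  obtain ⟨X, i, j, P, h1, h2⟩ := (quantumIso_iff G H).1 h
  exact (quantumIso_iff _ _).2 ⟨X, i, j, P, h1.compl, h2⟩

theorem quantumIso_component {G H : FinGraph} {X : Type} [CStarAlgebra X]
    {P : H.V → G.V → X} (h1 : GraphMagic G.graph H.graph P)
    (h2 : ∀ y x, star (P y x) = P y x) {D : H.graph.ConnectedComponent}
    {C : G.graph.ConnectedComponent} (h : GraphMagic.block G.graph H.graph P D C ≠ 0) :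
    (G.component C).QuantumIso (H.component D) := by
  have hs : star (GraphMagic.block G.graph H.graph P D C) =
      GraphMagic.block G.graph H.graph P D C := by
    simp only [GraphMagic.block, GraphMagic.colBlock, star_sum, h2]
  refine (quantumIso_iff _ _).2 ⟨(h1.block_idem D C).Corner, Corner.cstarAlgebra _ hs,
    Corner.nontrivial _ h, h1.cornerBlock D C, h1.cornerBlock_graphMagic D C, ?_⟩
  exact fun (y : D) (x : C) => Corner.val_injective _ (h2 y x)

end FinGraph

/-! ### Isomorphisms and connected components -/

namespace SimpleGraph

variable {V W : Type*} {G : SimpleGraph V} {H : SimpleGraph W}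

/-- Isomorphisms between the components glue to an isomorphism. -/
theorem exists_iso_of_components (σ : G.ConnectedComponent ≃ H.ConnectedComponent)
    (φ : ∀ C, C.toSimpleGraph ≃g (σ C).toSimpleGraph) :
    ∃ f : G ≃g H, ∀ (C : G.ConnectedComponent) (x : C), f x = φ C x := by
  let f : V → W := fun x => φ (G.connectedComponentMk x) ⟨x, rfl⟩
  have hf : ∀ (C : G.ConnectedComponent) (x : C), f x = φ C x := by
    rintro C ⟨x, rfl⟩
    rfl
  have hmk : ∀ x, H.connectedComponentMk (f x) = σ (G.connectedComponentMk x) :=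
    fun x => (φ (G.connectedComponentMk x) ⟨x, rfl⟩).2
  have hinj : Function.Injective f := by
    intro x x' h
    have hc : G.connectedComponentMk x' = G.connectedComponentMk x :=
      σ.injective (by rw [← hmk, ← hmk, h])
    rw [hf _ ⟨x, rfl⟩, hf (G.connectedComponentMk x) ⟨x', hc⟩] at h
    exact congrArg Subtype.val ((φ _).injective (Subtype.coe_injective h))
  have hsurj : Function.Surjective f := by
    intro y
    have hy : H.connectedComponentMk y = σ (σ.symm (H.connectedComponentMk y)) := by simp
    refine ⟨(φ (σ.symm (H.connectedComponentMk y))).symm ⟨y, hy⟩, ?_⟩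
    rw [hf, RelIso.apply_symm_apply]
  refine ⟨⟨Equiv.ofBijective f ⟨hinj, hsurj⟩, ?_⟩, hf⟩
  intro x x'
  change H.Adj (f x) (f x') ↔ G.Adj x x'
  by_cases hc : G.connectedComponentMk x' = G.connectedComponentMk x
  · rw [hf _ ⟨x, rfl⟩, hf (G.connectedComponentMk x) ⟨x', hc⟩]
    exact (φ (G.connectedComponentMk x)).map_adj_iff (v := ⟨x, rfl⟩) (w := ⟨x', hc⟩)
  · refine ⟨fun h => ?_, fun h => ?_⟩
    · exact absurd (σ.injective (by
        rw [← hmk, ← hmk, ConnectedComponent.connectedComponentMk_eq_of_adj h])) hc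
    · exact absurd (ConnectedComponent.connectedComponentMk_eq_of_adj h).symm hc

/-- An isomorphism between two components extends, by its inverse and the identity, to an
automorphism of the graph. -/
theorem exists_aut_of_component_iso {C D : G.ConnectedComponent}
    (φ : C.toSimpleGraph ≃g D.toSimpleGraph) :
    ∃ f : G ≃g G, (∀ x : C, f x = φ x) ∧
      ∀ x, G.connectedComponentMk x ≠ C → G.connectedComponentMk x ≠ D → f x = x := by
  classical
  have key : ∀ E, ∃ ψ : E.toSimpleGraph ≃g (Equiv.swap C D E).toSimpleGraph,
      ∀ x : E, (∀ h : E = C, (ψ x : V) = φ ⟨x, h ▸ x.2⟩) ∧ (E ≠ C → E ≠ D → (ψ x : V) = x) := by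
    intro E
    -- Naming the image component as a variable lets each case substitute its value, avoiding casts
    -- between component types.
    obtain ⟨F, hF⟩ : ∃ F, F = Equiv.swap C D E := ⟨_, rfl⟩
    rw [← hF]
    by_cases hC : E = C
    · subst hC
      rw [Equiv.swap_apply_left] at hF
      subst hF
      exact ⟨φ, fun x => ⟨fun _ => rfl, fun h => absurd rfl h⟩⟩
    · by_cases hD : E = D
      · subst hD
        rw [Equiv.swap_apply_right] at hF
        subst hF
        exact ⟨φ.symm, fun x => ⟨fun h => absurd h hC, fun _ h => absurd rfl h⟩⟩
      · rw [Equiv.swap_apply_of_ne_of_ne hC hD] at hF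
        subst hF
        exact ⟨RelIso.refl _, fun x => ⟨fun h => absurd h hC, fun _ _ => rfl⟩⟩
  choose ψ hψ using key
  obtain ⟨f, hf⟩ := exists_iso_of_components (Equiv.swap C D) ψ
  refine ⟨f, fun x => ?_, fun x h1 h2 => ?_⟩
  · rw [hf, (hψ C x).1 rfl]
  · rw [hf _ ⟨x, rfl⟩]
    exact (hψ _ _).2 h1 h2

theorem exists_aut_of_component_aut {C : G.ConnectedComponent}
    (φ : C.toSimpleGraph ≃g C.toSimpleGraph) :
    ∃ f : G ≃g G, (∀ x : C, f x = φ x) ∧ ∀ x, G.connectedComponentMk x ≠ C → f x = x := by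
  obtain ⟨f, h1, h2⟩ := exists_aut_of_component_iso φ
  exact ⟨f, h1, fun x h => h2 x h h⟩

/-- Since the image of `f` is closed under adjacency, a walk starting in it never leaves it and
lifts to `G`. -/
theorem reachable_of_closed_embedding (f : G ↪g H)
    (hcl : ∀ x z, H.Adj (f x) z → ∃ y, f y = z) {a b : W} (p : H.Walk a b) :
    ∀ x, f x = a → ∃ y, f y = b ∧ G.Reachable x y := by
  induction p with
  | nil => exact fun x hx => ⟨x, hx, Reachable.refl _⟩
  | cons h p ih =>
    rintro x rfl
    obtain ⟨y, rfl⟩ := hcl _ _ h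
    obtain ⟨z, hz, hyz⟩ := ih y rfl
    exact ⟨z, hz, (f.map_adj_iff.1 h).reachable.trans hyz⟩

/-- Components are preserved by embeddings onto unions of components. -/
theorem component_iso_of_closed_embedding (f : G ↪g H)
    (hcl : ∀ x z, H.Adj (f x) z → ∃ y, f y = z) (x : V) :
    Nonempty ((G.connectedComponentMk x).toSimpleGraph ≃g
      (H.connectedComponentMk (f x)).toSimpleGraph) := by
  let g : G.connectedComponentMk x → H.connectedComponentMk (f x) := fun y =>
    ⟨f y, ConnectedComponent.sound ((ConnectedComponent.exact y.2).map f.toHom)⟩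
  have hg : Function.Bijective g := by
    refine ⟨fun y y' h => Subtype.ext (f.injective (congrArg Subtype.val h)), ?_⟩
    rintro ⟨z, hz⟩
    obtain ⟨p⟩ := (ConnectedComponent.exact hz).symm
    obtain ⟨y, rfl, hxy⟩ := reachable_of_closed_embedding f hcl p x rfl
    exact ⟨⟨y, ConnectedComponent.sound hxy.symm⟩, rfl⟩
  exact ⟨⟨Equiv.ofBijective g hg, f.map_adj_iff⟩⟩

theorem iso_component_of_preconnected (h : G.Preconnected) (C : G.ConnectedComponent) :
    Nonempty (C.toSimpleGraph ≃g G) :=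
  ⟨⟨Equiv.ofBijective (Subtype.val : C → V) ⟨Subtype.val_injective, fun x =>
    ⟨⟨x, by
      induction C using ConnectedComponent.ind with
      | h v => exact ConnectedComponent.sound (h x v)⟩, rfl⟩⟩, Iff.rfl⟩⟩

theorem card_component_lt [Fintype V] (h : ¬ G.Preconnected) (C : G.ConnectedComponent) :
    Fintype.card C < Fintype.card V := by
  classical
  refine lt_of_le_of_ne (Fintype.card_le_of_injective _ Subtype.val_injective) fun hc => h ?_
  have hb := (Fintype.bijective_iff_injective_and_card (Subtype.val : C → V)).2
    ⟨Subtype.val_injective, hc⟩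
  intro x y
  obtain ⟨x, rfl⟩ := hb.2 x
  obtain ⟨y, rfl⟩ := hb.2 y
  exact C.reachable_of_mem_supp x.2 y.2

theorem preconnected_compl_sum {V W : Type*} [Nonempty V] [Nonempty W] (G : SimpleGraph V)
    (H : SimpleGraph W) : (G ⊕g H)ᶜ.Preconnected := by
  have hadj : ∀ v w, (G ⊕g H)ᶜ.Reachable (Sum.inl v) (Sum.inr w) := fun v w =>
    Adj.reachable (by simp [compl_adj])
  rintro (x | x) (y | y)
  · exact (hadj x (Classical.arbitrary W)).trans (hadj y (Classical.arbitrary W)).symm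
  · exact hadj x y
  · exact (hadj y x).symm
  · exact (hadj (Classical.arbitrary V) x).symm.trans (hadj (Classical.arbitrary V) y)

/-- The isomorphism between complements. -/
def Iso.complement (f : G ≃g H) : Gᶜ ≃g Hᶜ :=
  ⟨f.toEquiv, by
    intro x y
    change Hᶜ.Adj (f x) (f y) ↔ _
    simp [compl_adj, f.map_adj_iff]⟩

end SimpleGraph

/-! ### Graph classes -/

namespace FinGraph

theorem Iso.symm {G H : FinGraph} (h : G.Iso H) : H.Iso G := h.map RelIso.symm

theorem Iso.compl {G H : FinGraph} (h : G.Iso H) : G.compl.Iso H.compl :=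
  h.map SimpleGraph.Iso.complement

theorem compl_compl (G : FinGraph) : G.compl.compl = G := by
  obtain ⟨V, g⟩ := G
  exact congrArg (FinGraph.mk V) (_root_.compl_compl g)

theorem compl_iso_compl_iff {G H : FinGraph} : G.compl.Iso H.compl ↔ G.Iso H :=
  ⟨fun h => by simpa only [compl_compl] using h.compl, Iso.compl⟩

theorem sum_iso_left (G H : FinGraph) [IsEmpty H.V] : G.Iso (G.sum H) :=
  ⟨⟨(Equiv.sumEmpty _ _).symm, Iff.rfl⟩⟩

theorem sum_iso_right (G H : FinGraph) [IsEmpty G.V] : H.Iso (G.sum H) :=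
  ⟨⟨(Equiv.emptySum _ _).symm, Iff.rfl⟩⟩

theorem Iso.exists_component {G H : FinGraph} (h : G.Iso H) (D : H.graph.ConnectedComponent) :
    ∃ C, (G.component C).Iso (H.component D) := by
  obtain ⟨f⟩ := h
  induction D using SimpleGraph.ConnectedComponent.ind with
  | h y =>
    obtain ⟨x, rfl⟩ := f.surjective y
    exact ⟨_, SimpleGraph.component_iso_of_closed_embedding f.toEmbedding
      (fun _ z _ => f.surjective z) x⟩

theorem exists_component_of_sum {G H : FinGraph} (D : (G.sum H).graph.ConnectedComponent) :
    (∃ C, (G.component C).Iso ((G.sum H).component D)) ∨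
      ∃ C, (H.component C).Iso ((G.sum H).component D) := by
  induction D using SimpleGraph.ConnectedComponent.ind with
  | h y =>
    rcases y with x | x
    · refine Or.inl ⟨_, SimpleGraph.component_iso_of_closed_embedding
        SimpleGraph.Embedding.sumInl ?_ x⟩
      rintro x (z | z) h
      · exact ⟨z, rfl⟩
      · simp at h
    · refine Or.inr ⟨_, SimpleGraph.component_iso_of_closed_embedding
        SimpleGraph.Embedding.sumInr ?_ x⟩
      rintro x (z | z) h
      · simp at h
      · exact ⟨z, rfl⟩

end FinGraph

namespace GraphClass

variable {F : GraphClass}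

/-- The complement is carried along so that the induction passes through complementation. A sum of
two nonempty graphs has a connected complement, whose only component is the complement itself. -/
theorem InCo.components (hcompl : F.StableCompl) (hcomp : F.StableComponents) {G : FinGraph}
    (hG : F.InCo G) : (∀ C, F.InCo (G.component C)) ∧ ∀ C, F.InCo (G.compl.component C) := by
  induction hG with
  | base h => exact ⟨fun C => .base (hcomp _ h C), fun C => .base (hcomp _ (hcompl _ h) C)⟩
  | @sum G H hG hH ihG ihH =>
    refine ⟨fun D => ?_, fun D => ?_⟩
    · rcases FinGraph.exists_component_of_sum D with ⟨C, h⟩ | ⟨C, h⟩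
      · exact .iso h (ihG.1 C)
      · exact .iso h (ihH.1 C)
    · rcases isEmpty_or_nonempty G.V with _ | _
      · obtain ⟨C, hC⟩ := (FinGraph.sum_iso_right G H).compl.exists_component D
        exact .iso hC (ihH.2 C)
      · rcases isEmpty_or_nonempty H.V with _ | _
        · obtain ⟨C, hC⟩ := (FinGraph.sum_iso_left G H).compl.exists_component D
          exact .iso hC (ihG.2 C)
        · refine .iso (FinGraph.Iso.symm ?_) (hG.sum hH).compl
          exact SimpleGraph.iso_component_of_preconnected
            (SimpleGraph.preconnected_compl_sum G.graph H.graph) D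
  | @compl G hG ih =>
    -- Components depend on the graph as a type, so the equality of `G` with its double complement
    -- is used by substitution.
    have h : ∀ K : FinGraph, K = G → ∀ C, F.InCo (K.component C) := by
      rintro K rfl
      exact ih.1
    exact ⟨ih.2, h _ G.compl_compl⟩
  | iso h hG ih =>
    refine ⟨fun D => ?_, fun D => ?_⟩
    · obtain ⟨C, hC⟩ := h.exists_component D
      exact .iso hC (ih.1 C)
    · obtain ⟨C, hC⟩ := h.compl.exists_component D
      exact .iso hC (ih.2 C)

theorem mem_compl_iff (hcompl : F.StableCompl) (G : FinGraph) : G.compl ∈ F ↔ G ∈ F :=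
  ⟨fun h => by simpa only [FinGraph.compl_compl] using hcompl _ h, hcompl G⟩

theorem InCo.mem_or_not_preconnected (hcompl : F.StableCompl) {G : FinGraph} (hG : F.InCo G) :
    G ∈ F ∨ ¬ G.graph.Preconnected ∨ ¬ G.compl.graph.Preconnected := by
  induction hG with
  | base h => exact Or.inl h
  | @sum G H hG hH ihG ihH =>
    -- An empty summand does not disconnect the sum; the claim is then inherited from the other
    -- summand.
    rcases isEmpty_or_nonempty G.V with _ | _
    · obtain ⟨f⟩ := FinGraph.sum_iso_right G H
      have h1 := f.preconnected_iff
      have h2 := f.complement.preconnected_iff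
      exact ihH.imp (F.iso_mem ⟨f⟩) (Or.imp (mt h1.2) (mt h2.2))
    · rcases isEmpty_or_nonempty H.V with _ | _
      · obtain ⟨f⟩ := FinGraph.sum_iso_left G H
        have h1 := f.preconnected_iff
        have h2 := f.complement.preconnected_iff
        exact ihG.imp (F.iso_mem ⟨f⟩) (Or.imp (mt h1.2) (mt h2.2))
      · exact Or.inr (Or.inl SimpleGraph.not_preconnected_sum)
  | @compl G hG ih =>
    rw [mem_compl_iff hcompl, FinGraph.compl_compl]
    tauto
  | iso h hG ih =>
    obtain ⟨f⟩ := h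
    have h1 := f.preconnected_iff
    have h2 := f.complement.preconnected_iff
    exact ih.imp (F.iso_mem ⟨f⟩) (Or.imp (mt h1.2) (mt h2.2))

end GraphClass

/-! ### Matching components by counting, and the axiom (QI) -/

namespace GraphMagic

variable {V W B : Type*} [Fintype V] [Fintype W] [Ring B] {G : SimpleGraph V}
  {H : SimpleGraph W} {u : W → V → B}

/-- If a magic matrix is supported on the pairs of indices with equal labels, then there is a
label-preserving bijection between the indices. -/
theorem exists_equiv_of_label [Nontrivial B] [Algebra ℂ B] {T : Type*} (hu : GraphMagic G H u)
    (f : V → T) (g : W → T) (h : ∀ y x, u y x ≠ 0 → f x = g y) :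
    ∃ σ : V ≃ W, ∀ x, g (σ x) = f x := by
  classical
  have : CharZero B := by
    have := algebraRat.charZero ℂ
    exact charZero_of_injective_algebraMap (algebraMap ℂ B).injective
  -- Summing the entries over the columns labelled `t` or over the rows labelled `t` gives the same
  -- element, since the entries where these sums differ are zero; characteristic zero recovers the
  -- cardinals.
  have hcard : ∀ t, Fintype.card {x // f x = t} = Fintype.card {y // g y = t} := by
    intro t
    have h1 : ∑ x with f x = t, ∑ y, u y x = (Fintype.card {x // f x = t} : B) := by
      simp [hu.col_sum, Fintype.card_subtype]
    have h2 : ∑ y with g y = t, ∑ x, u y x = (Fintype.card {y // g y = t} : B) := by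
      simp [hu.row_sum, Fintype.card_subtype]
    rw [← Nat.cast_inj (R := B), ← h1, ← h2, Finset.sum_filter, Finset.sum_filter]
    have h3 : ∀ y x, (if f x = t then u y x else 0) = if g y = t then u y x else 0 := by
      intro y x
      by_cases h0 : u y x = 0
      · simp [h0]
      · rw [h y x h0]
    calc ∑ x, (if f x = t then ∑ y, u y x else 0)
        = ∑ x, ∑ y, if f x = t then u y x else 0 :=
          Finset.sum_congr rfl fun x _ => by split_ifs <;> simp
      _ = ∑ y, ∑ x, if g y = t then u y x else 0 := by
          rw [Finset.sum_comm]
          simp only [h3]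
      _ = ∑ y, if g y = t then ∑ x, u y x else 0 :=
          Finset.sum_congr rfl fun y _ => by split_ifs <;> simp
  let σ := Equiv.ofFiberEquiv (f := f) (g := g) fun t => Fintype.equivOfCardEq (hcard t)
  exact ⟨σ, fun x => Equiv.ofFiberEquiv_map _ x⟩

/-- If the blocks of a magic matrix vanish outside pairs of isomorphic components, then the graphs
are isomorphic. -/
theorem nonempty_iso_of_block [Nontrivial B] [Algebra ℂ B] (hu : GraphMagic G H u)
    (h : ∀ D C, block G H u D C ≠ 0 → Nonempty (C.toSimpleGraph ≃g D.toSimpleGraph)) :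
    Nonempty (G ≃g H) := by
  -- The label of a component, of either graph, is the set of components of `G` isomorphic to it.
  -- The label of `C` contains `C`, so equal labels give an isomorphism.
  obtain ⟨σ, hσ⟩ := hu.block_graphMagic.exists_equiv_of_label
    (fun C => {E : G.ConnectedComponent | Nonempty (C.toSimpleGraph ≃g E.toSimpleGraph)})
    (fun D => {E : G.ConnectedComponent | Nonempty (D.toSimpleGraph ≃g E.toSimpleGraph)})
    (fun D C hDC => by
      obtain ⟨φ⟩ := h D C hDC
      ext E
      exact ⟨fun ⟨ψ⟩ => ⟨φ.symm.trans ψ⟩, fun ⟨ψ⟩ => ⟨φ.trans ψ⟩⟩)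
  have key : ∀ C, Nonempty (C.toSimpleGraph ≃g (σ C).toSimpleGraph) := by
    intro C
    have hC : C ∈ {E : G.ConnectedComponent |
        Nonempty ((σ C).toSimpleGraph ≃g E.toSimpleGraph)} := by
      rw [hσ C]
      exact ⟨RelIso.refl _⟩
    exact hC.map RelIso.symm
  obtain ⟨f, -⟩ := SimpleGraph.exists_iso_of_components σ fun C => (key C).some
  exact ⟨f⟩

end GraphMagic

namespace FinGraph

theorem QuantumIso.card_eq {G H : FinGraph} (h : G.QuantumIso H) :
    Fintype.card G.V = Fintype.card H.V := by
  obtain ⟨X, _, _, P, h, -⟩ := (quantumIso_iff G H).1 h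
  exact h.card_eq

theorem QuantumIso.iso_of_components {G H : FinGraph} (h : G.QuantumIso H)
    (hc : ∀ C D, (G.component C).QuantumIso (H.component D) →
      (G.component C).Iso (H.component D)) : G.Iso H := by
  obtain ⟨X, _, _, P, h1, h2⟩ := (quantumIso_iff G H).1 h
  exact h1.nonempty_iso_of_block fun D C hDC => hc C D (quantumIso_component h1 h2 hDC)

end FinGraph

namespace GraphClass

variable {F : GraphClass}

theorem QI.co (hcompl : F.StableCompl) (hcomp : F.StableComponents) (hQI : F.QI) :
    F.co.QI := by
  have key : ∀ n, ∀ G H : FinGraph, F.InCo G → F.InCo H → Fintype.card G.V = n →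
      G.QuantumIso H → G.Iso H := by
    intro n
    induction n using Nat.strong_induction_on with
    | _ n ih =>
      have step : ∀ G H : FinGraph, F.InCo G → F.InCo H → Fintype.card G.V = n →
          G.QuantumIso H → (¬ G.graph.Preconnected ∨ ¬ H.graph.Preconnected) → G.Iso H := by
        intro G H hG hH hn hq hp
        refine hq.iso_of_components fun C D hCD => ?_
        refine ih _ ?_ _ _ ((hG.components hcompl hcomp).1 C)
          ((hH.components hcompl hcomp).1 D) rfl hCD
        -- Either graph may be the disconnected one; quantum isomorphic graphs have equally many
        -- vertices, so a bound on `D` also bounds `C`.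
        rcases hp with hp | hp
        · exact hn ▸ SimpleGraph.card_component_lt hp C
        · rw [hCD.card_eq, ← hn, hq.card_eq]
          exact SimpleGraph.card_component_lt hp D
      intro G H hG hH hn hq
      have hG' := hG.mem_or_not_preconnected hcompl
      have hH' := hH.mem_or_not_preconnected hcompl
      by_cases hp : ¬ G.graph.Preconnected ∨ ¬ H.graph.Preconnected
      · exact step G H hG hH hn hq hp
      by_cases hp' : ¬ G.compl.graph.Preconnected ∨ ¬ H.compl.graph.Preconnected
      · exact FinGraph.compl_iso_compl_iff.1 (step _ _ hG.compl hH.compl hn hq.compl hp')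
      exact (hQI G (by tauto) H (by tauto)).1 hq
  exact fun G hG H hH => ⟨key _ G H hG hH rfl, FinGraph.Iso.quantumIso⟩

end GraphClass

/-! ### The universal property of the quantum automorphism group -/

namespace FinGraph

variable (G : FinGraph)

/-- The matrix of generators of `O(Qu(G))`. -/
def fund (x y : G.V) : G.OQu := UnivStarAlg.gen _ (x, y)

theorem mk_varMatrix (x y : G.V) :
    UnivStarAlg.mk (relPs G.V ∪ G.relAdj) (varMatrix G.V x y) = G.fund x y := rfl

theorem mk_eq_of_sub_mem {a b : StarPoly (G.V × G.V)} (h : a - b ∈ relPs G.V ∪ G.relAdj) :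
    UnivStarAlg.mk (relPs G.V ∪ G.relAdj) a = UnivStarAlg.mk (relPs G.V ∪ G.relAdj) b := by
  rw [← sub_eq_zero, ← map_sub]
  exact UnivStarAlg.mk_eq_zero _ h

theorem star_fund (x y : G.V) : star (G.fund x y) = G.fund x y := by
  rw [← mk_varMatrix, ← UnivStarAlg.mk_star]
  exact G.mk_eq_of_sub_mem (Or.inl (Or.inl (Or.inl (Or.inl ⟨x, y, rfl⟩))))

theorem fund_graphMagic : GraphMagic G.graph G.graph G.fund := by
  classical
  refine GraphMagic.of_mul_adjMatrix ?_ ?_ ?_ ?_ ?_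
  · intro y
    have := G.mk_eq_of_sub_mem (Or.inl (Or.inl (Or.inr (Or.inl ⟨y, rfl⟩))))
    simpa only [map_sum, map_one, mk_varMatrix] using this
  · intro x
    have := G.mk_eq_of_sub_mem (Or.inl (Or.inl (Or.inr (Or.inr ⟨x, rfl⟩))))
    simpa only [map_sum, map_one, mk_varMatrix] using this
  · intro y x x' h
    have := G.mk_eq_of_sub_mem (Or.inl (Or.inr (Or.inl ⟨y, x, x', rfl⟩)))
    simpa only [map_mul, mk_varMatrix, if_neg h, map_zero] using this
  · intro x y y' h
    have := G.mk_eq_of_sub_mem (Or.inl (Or.inr (Or.inr ⟨y, x, y', rfl⟩)))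
    simpa only [map_mul, mk_varMatrix, if_neg h, map_zero] using this
  · ext i j
    have := G.mk_eq_of_sub_mem (Or.inr ⟨i, j, rfl⟩)
    simp only [Matrix.mul_apply, map_sum, map_mul, mk_varMatrix, adj,
      SimpleGraph.adjMatrix_apply, apply_ite (UnivStarAlg.mk (relPs G.V ∪ G.relAdj)), map_one,
      map_zero] at this
    simp only [Matrix.mul_apply, Matrix.of_apply, SimpleGraph.adjMatrix_apply]
    exact this.symm

/-- The generators are self-adjoint, so adjoining them as an algebra already captures their
adjoints. -/
theorem adjoin_fund : Algebra.adjoin ℂ (Set.range fun p : G.V × G.V => G.fund p.1 p.2) = ⊤ := by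
  rw [eq_top_iff]
  rintro a -
  obtain ⟨a, rfl⟩ := UnivStarAlg.mk_surjective _ a
  induction a using StarPoly.letters_induction with
  | h1 c =>
    rw [AlgHom.commutes]
    exact Subalgebra.algebraMap_mem _ c
  | h2 l =>
    obtain ⟨⟨x, y⟩, _ | _⟩ := l
    · exact Algebra.subset_adjoin ⟨(x, y), rfl⟩
    · have h : (StarPoly.letter ((x, y), true) : StarPoly (G.V × G.V)) =
          star (varMatrix G.V x y) := (StarPoly.star_letter ((x, y), false)).symm
      rw [h, UnivStarAlg.mk_star, mk_varMatrix, star_fund]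
      exact Algebra.subset_adjoin ⟨(x, y), rfl⟩
  | h3 a b ha hb =>
    rw [map_mul]
    exact Subalgebra.mul_mem _ ha hb
  | h4 a b ha hb =>
    rw [map_add]
    exact Subalgebra.add_mem _ ha hb

/-- A magic matrix over an algebra defines a morphism of algebras. -/
theorem exists_algHom {B : Type*} [Ring B] [Algebra ℂ B] {u : G.V → G.V → B}
    (hu : GraphMagic G.graph G.graph u) :
    ∃ φ : G.OQu →ₐ[ℂ] B, ∀ x y, φ (G.fund x y) = u x y := by
  classical
  let f : StarPoly (G.V × G.V) →ₐ[ℂ] B := StarPoly.liftLetters fun l => u l.1.1 l.1.2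
  have hX : ∀ x y, f (varMatrix G.V x y) = u x y := fun x y => StarPoly.liftLetters_letter _ _
  have hX' : ∀ x y, f (star (varMatrix G.V x y)) = u x y := fun x y => by
    change f (star (StarPoly.letter ((x, y), false))) = u x y
    rw [StarPoly.star_letter]
    exact StarPoly.liftLetters_letter _ _
  have hA : ∀ i j, ∑ k, (if G.graph.Adj i k then (1 : B) else 0) * u k j -
      ∑ k, u i k * (if G.graph.Adj k j then (1 : B) else 0) = 0 := fun i j => by
    have := congrFun (congrFun hu.mul_adjMatrix i) j
    simp only [Matrix.mul_apply, Matrix.of_apply, SimpleGraph.adjMatrix_apply] at this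
    rw [this, sub_self]
  -- `B` carries no involution, so adjoints of relators are checked directly: they are again magic
  -- relations, with products reversed.
  have hR : ∀ a ∈ relPs G.V ∪ G.relAdj, f a = 0 ∧ f (star a) = 0 := by
    rintro a ((((⟨i, j, rfl⟩ | ⟨i, j, rfl⟩) | ⟨i, rfl⟩ | ⟨i, rfl⟩) |
      ⟨i, j, k, rfl⟩ | ⟨i, j, k, rfl⟩) | ⟨i, j, rfl⟩)
    · simp [hX, hX']
    · simp [hX, hX', pow_two, hu.idem]
    · simp [hX, hX', star_sum, hu.row_sum]
    · simp [hX, hX', star_sum, hu.col_sum]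
    · by_cases h : j = k
      · subst h; simp [hX, hX', hu.idem]
      · simp [hX, hX', h, hu.row_orth _ _ _ h, hu.row_orth _ _ _ (Ne.symm h)]
    · by_cases h : i = k
      · subst h; simp [hX, hX', hu.idem]
      · simp [hX, hX', h, hu.col_orth _ _ _ h, hu.col_orth _ _ _ (Ne.symm h)]
    · have h1 := hA i j
      simp only [ite_mul, mul_ite, one_mul, mul_one, zero_mul, mul_zero] at h1
      constructor
      · simpa [Matrix.mul_apply, adj, SimpleGraph.adjMatrix_apply, hX, apply_ite f] using h1
      · simpa [Matrix.mul_apply, adj, SimpleGraph.adjMatrix_apply, hX', apply_ite f,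
          star_sum, apply_ite star] using h1
  have hrel : ∀ ⦃x y⦄, starRel (relPs G.V ∪ G.relAdj) x y → f x = f y := by
    rintro x y ⟨h | h, rfl⟩
    · rw [map_zero, (hR _ h).1]
    · rw [map_zero, ← star_star x, (hR _ h).2]
  refine ⟨RingQuot.liftAlgHom ℂ ⟨f, hrel⟩, fun x y => ?_⟩
  exact (RingQuot.liftAlgHom_mkAlgHom_apply ℂ f hrel _).trans (hX x y)

end FinGraph

/-! ### Graphs with trivial or classical quantum automorphism group -/

namespace SimpleGraph

variable {V : Type} [Fintype V]

/-- Every magic matrix that commutes with the graph is the identity. -/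
def QuantumRigid (G : SimpleGraph V) : Prop :=
  ∀ (B : Type) [Ring B] [Algebra ℂ B] (u : V → V → B), GraphMagic G G u →
    (∀ x, u x x = 1) ∧ ∀ x y, x ≠ y → u x y = 0

/-- Every magic matrix that commutes with the graph has commuting coefficients. -/
def QuantumClassical (G : SimpleGraph V) : Prop :=
  ∀ (B : Type) [Ring B] [Algebra ℂ B] (u : V → V → B), GraphMagic G G u →
    ∀ x y x' y', Commute (u x y) (u x' y')

theorem QuantumRigid.compl {G : SimpleGraph V} (h : G.QuantumRigid) : Gᶜ.QuantumRigid :=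
  fun B _ _ u hu => h B u (by simpa using hu.compl)

theorem QuantumClassical.compl {G : SimpleGraph V} (h : G.QuantumClassical) :
    Gᶜ.QuantumClassical :=
  fun B _ _ u hu => h B u (by simpa using hu.compl)

end SimpleGraph

namespace FinGraph

variable (G : FinGraph)

theorem trivialQu_iff : G.TrivialQu ↔ G.graph.QuantumRigid := by
  classical
  have hδ := GraphMagic.ofIso (B := ℂ) (RelIso.refl _ : G.graph ≃g G.graph)
  -- This is the counit. It shows that scalars embed in `O(Qu(G))` and determines the value of a
  -- generator known to be scalar.
  obtain ⟨ε, hε⟩ := G.exists_algHom hδ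
  constructor
  · intro h B _ _ u hu
    have hfund : ∀ x y, G.fund x y = algebraMap ℂ _ (if x = y then 1 else 0) := by
      intro x y
      obtain ⟨c, hc⟩ := h.2 (G.fund x y)
      have := hε x y
      rw [← hc, AlgHom.commutes] at this
      rw [← hc]
      congr 1
    obtain ⟨φ, hφ⟩ := G.exists_algHom hu
    refine ⟨fun x => ?_, fun x y hxy => ?_⟩
    · rw [← hφ, hfund, if_pos rfl, map_one, map_one]
    · rw [← hφ, hfund, if_neg hxy, map_zero, map_zero]
  · intro h
    obtain ⟨h1, h2⟩ := h _ _ G.fund_graphMagic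
    refine ⟨fun a b hab => ?_, fun a => ?_⟩
    · have := congrArg ε hab
      rwa [AlgHom.commutes, AlgHom.commutes] at this
    · have ha : a ∈ (⊥ : Subalgebra ℂ G.OQu) := by
        have ht : a ∈ (⊤ : Subalgebra ℂ G.OQu) := Algebra.mem_top
        rw [← G.adjoin_fund] at ht
        refine Algebra.adjoin_le ?_ ht
        rintro _ ⟨⟨x, y⟩, rfl⟩
        by_cases hxy : x = y
        · subst hxy
          simp only [h1]
          exact one_mem _
        · simp only [h2 _ _ hxy]
          exact zero_mem _
      exact Algebra.mem_bot.1 ha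

theorem quantumSymmetry_iff : G.QuantumSymmetry ↔ ¬ G.graph.QuantumClassical := by
  refine not_congr ⟨fun h B _ _ u hu x y x' y' => ?_, fun h a b => ?_⟩
  · obtain ⟨φ, hφ⟩ := G.exists_algHom hu
    rw [← hφ, ← hφ]
    exact Commute.map (h _ _) φ
  · have ht : ∀ a : G.OQu, a ∈ Algebra.adjoin ℂ
        (Set.range fun p : G.V × G.V => G.fund p.1 p.2) := fun a => by
      rw [G.adjoin_fund]
      exact Algebra.mem_top
    refine Algebra.commute_of_mem_adjoin_of_forall_mem_commute (ht b) ?_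
    rintro _ ⟨p, rfl⟩
    refine (Algebra.commute_of_mem_adjoin_of_forall_mem_commute (ht a) ?_).symm
    rintro _ ⟨q, rfl⟩
    exact h _ _ G.fund_graphMagic _ _ _ _

end FinGraph

/-! ### Rigid graphs: magic matrices become isomorphisms -/

namespace GraphMagic

open scoped TensorProduct

variable {V W B : Type} [Fintype V] [Fintype W] [Ring B] {G : SimpleGraph V}
  {H : SimpleGraph W} {u : W → V → B}

/-- This composes `u` with its transpose to return from `H` to `G`. Placing the two factors in
different tensor legs makes them commute, which the magic relations of the composite require. -/
theorem tensor [Algebra ℂ B] (hu : GraphMagic G H u) :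
    GraphMagic G G (fun x x' => ∑ y, u y x ⊗ₜ[ℂ] u y x') := by
  have hmul : ∀ x₁ x₂ x₁' x₂', (∑ y, u y x₁ ⊗ₜ[ℂ] u y x₁') * (∑ y, u y x₂ ⊗ₜ[ℂ] u y x₂') =
      ∑ y, ∑ y', (u y x₁ * u y' x₂) ⊗ₜ[ℂ] (u y x₁' * u y' x₂') := by
    intro x₁ x₂ x₁' x₂'
    simp only [Finset.sum_mul_sum, Algebra.TensorProduct.tmul_mul_tmul]
  refine ⟨fun x => ?_, fun x => ?_, fun x x₁ x₂ h => ?_, fun x x₁ x₂ h => ?_,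
    fun x₁ x₂ z₁ z₂ h => ?_⟩
  · rw [Finset.sum_comm]
    simp only [← TensorProduct.tmul_sum, hu.row_sum]
    rw [← TensorProduct.sum_tmul, hu.col_sum]
    rfl
  · rw [Finset.sum_comm]
    simp only [← TensorProduct.sum_tmul, hu.row_sum]
    rw [← TensorProduct.tmul_sum, hu.col_sum]
    rfl
  · rw [hmul]
    refine Finset.sum_eq_zero fun y _ => Finset.sum_eq_zero fun y' _ => ?_
    by_cases hy : y = y'
    · subst hy
      rw [hu.row_orth y x₁ x₂ h, TensorProduct.tmul_zero]
    · rw [hu.col_orth x _ _ hy, TensorProduct.zero_tmul]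
  · rw [hmul]
    refine Finset.sum_eq_zero fun y _ => Finset.sum_eq_zero fun y' _ => ?_
    by_cases hy : y = y'
    · subst hy
      rw [hu.row_orth y x₁ x₂ h, TensorProduct.zero_tmul]
    · rw [hu.col_orth x _ _ hy, TensorProduct.tmul_zero]
  · rw [hmul]
    refine Finset.sum_eq_zero fun y _ => Finset.sum_eq_zero fun y' _ => ?_
    by_cases hy : G.Adj x₁ x₂ ↔ H.Adj y y'
    · rw [hu.adj_orth z₁ z₂ y y' fun h' => h (hy.trans h'.symm), TensorProduct.zero_tmul]
    · rw [hu.adj_orth _ _ _ _ hy, TensorProduct.tmul_zero]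

/-- A magic matrix from a quantum rigid graph is the matrix of an isomorphism. -/
theorem exists_iso_of_quantumRigid [Nontrivial B] [Algebra ℂ B] (hG : G.QuantumRigid)
    (hu : GraphMagic G H u) :
    ∃ f : G ≃g H, (∀ x, u (f x) x = 1) ∧ ∀ x y, y ≠ f x → u y x = 0 := by
  have h2 := (hG _ _ hu.tensor).2
  -- Rigidity kills the off-diagonal entries of the tensor matrix. Multiplying by `u y x ⊗ 1`
  -- isolates `u y x ⊗ u y x'`, and over a field a zero pure tensor has a zero factor. Each row thus
  -- has a single nonzero entry, equal to `1`.
  have key : ∀ y x x', x ≠ x' → u y x = 0 ∨ u y x' = 0 := by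
    intro y x x' h
    have h3 : u y x ⊗ₜ[ℂ] u y x' = 0 := by
      have h4 : (u y x ⊗ₜ[ℂ] (1 : B)) * ∑ y', u y' x ⊗ₜ[ℂ] u y' x' = u y x ⊗ₜ[ℂ] u y x' := by
        rw [Finset.mul_sum, Finset.sum_eq_single y]
        · rw [Algebra.TensorProduct.tmul_mul_tmul, hu.idem, one_mul]
        · intro y' _ hy
          rw [Algebra.TensorProduct.tmul_mul_tmul, hu.col_orth _ _ _ hy.symm,
            TensorProduct.zero_tmul]
        · simp
      have h5 : ∑ y', u y' x ⊗ₜ[ℂ] u y' x' = 0 := h2 _ _ h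
      rw [← h4, h5, mul_zero]
    by_contra! h4
    refine h4.1 ((Module.forall_dual_apply_eq_zero_iff ℂ _).1 fun φ => ?_)
    have h5 := congrArg (TensorProduct.lid ℂ B ∘ φ.rTensor B) h3
    simpa [h4.2] using h5
  have hex : ∀ y, ∃ x, u y x ≠ 0 := by
    intro y
    by_contra! h
    have := hu.row_sum y
    simp [h] at this
  choose g hg using hex
  have hg1 : ∀ y, u y (g y) = 1 := fun y => by
    rw [← hu.row_sum y]
    refine (Finset.sum_eq_single _ (fun x _ hx => ?_) (by simp)).symm
    exact (key y _ _ hx).resolve_right (hg y)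
  have hg0 : ∀ y x, x ≠ g y → u y x = 0 := fun y x hx =>
    (key y _ _ hx).resolve_right (hg y)
  have hinj : Function.Injective g := by
    intro y y' h
    by_contra hy
    have := hu.col_orth (g y) y y' hy
    rw [hg1, h, hg1, one_mul] at this
    exact one_ne_zero this
  have hbij : Function.Bijective g :=
    (Fintype.bijective_iff_injective_and_card g).2 ⟨hinj, hu.card_eq.symm⟩
  let e := Equiv.ofBijective g hbij
  have he : ∀ x, g (e.symm x) = x := e.apply_symm_apply
  refine ⟨⟨e.symm, ?_⟩, fun x => ?_, fun x y hy => hg0 _ _ ?_⟩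
  · intro x x'
    by_contra h
    have := hu.adj_orth x x' (e.symm x) (e.symm x') fun h' => h h'.symm
    have h1 := hg1 (e.symm x)
    have h2 := hg1 (e.symm x')
    rw [he] at h1 h2
    rw [h1, h2, one_mul] at this
    exact one_ne_zero this
  · have := hg1 (e.symm x)
    rwa [he] at this
  · rintro rfl
    exact hy (e.symm_apply_apply y).symm

end GraphMagic

/-! ### Commutation, mixing and products of magic matrices -/

namespace GraphMagic

section

variable {V W B : Type*} [Fintype V] [Fintype W] [Ring B] {G : SimpleGraph V}
  {H : SimpleGraph W} {u : W → V → B}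

theorem eq_zero_of_block (hu : GraphMagic G H u) {x : V} {y : W}
    (h : block G H u (H.connectedComponentMk y) (G.connectedComponentMk x) = 0) : u y x = 0 := by
  rw [← hu.block_mul, h, zero_mul]

theorem block_self_eq_one {u : V → V → B} (hu : GraphMagic G G u)
    (h : ∀ D C, D ≠ C → block G G u D C = 0) (C : G.ConnectedComponent) :
    block G G u C C = 1 := by
  rw [← hu.sum_block C]
  exact (Finset.sum_eq_single C (fun D _ hD => h D C hD) (by simp)).symm

theorem op (hu : GraphMagic G H u) : GraphMagic G H (fun y x => MulOpposite.op (u y x)) where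
  row_sum y := by rw [← Finset.op_sum, hu.row_sum, MulOpposite.op_one]
  col_sum y := by rw [← Finset.op_sum, hu.col_sum, MulOpposite.op_one]
  row_orth y x x' h := by rw [← MulOpposite.op_mul, hu.row_orth _ _ _ h.symm, MulOpposite.op_zero]
  col_orth y x x' h := by rw [← MulOpposite.op_mul, hu.col_orth _ _ _ h.symm, MulOpposite.op_zero]
  adj_orth x x' y y' h := by
    rw [← MulOpposite.op_mul, hu.adj_orth x' x y' y (by rwa [G.adj_comm, H.adj_comm]),
      MulOpposite.op_zero]

/-- Expand `u y x * u y' x'` by multiplying on the right by the row sum at `y`. For `z ≠ x`, the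
products `u y x * u y' w * u y z` sum over `w` to `u y x * u y z = 0`. The terms with `w` equal to
`x` or `z` vanish, and a nonzero term with `w ≠ x'` would produce the forbidden four indices, so the
term at `x'` is zero as well. -/
theorem mul_eq_mul_mul (hu : GraphMagic G H u)
    (h : ∀ y y' x₁ x₂ x₃ x₄, [x₁, x₂, x₃, x₄].Nodup →
      u y x₁ ≠ 0 → u y x₂ ≠ 0 → u y' x₃ ≠ 0 → u y' x₄ ≠ 0 → False)
    {y y' : W} {x x' : V} (hy : y ≠ y') :
    u y x * u y' x' = u y x * u y' x' * u y x := by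
  conv_lhs => rw [← mul_one (u y x * u y' x'), ← hu.row_sum y, Finset.mul_sum]
  refine Finset.sum_eq_single x (fun z _ hz => ?_) (by simp)
  by_cases hzx : z = x'
  · subst hzx
    rw [mul_assoc, hu.col_orth _ _ _ hy.symm, mul_zero]
  by_cases hxx : x' = x
  · subst hxx
    rw [hu.col_orth _ _ _ hy, zero_mul]
  have h1 : ∑ w, u y x * u y' w * u y z = 0 := by
    rw [← Finset.sum_mul, ← Finset.mul_sum, hu.row_sum, mul_one, hu.row_orth _ _ _ hz.symm]
  rw [← h1]
  by_contra hne
  refine hne (Eq.symm ?_)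
  refine Finset.sum_eq_single x' (fun w _ hw => ?_) (by simp)
  rw [h1] at hne
  by_cases hwx : w = x
  · subst hwx
    rw [hu.col_orth _ _ _ hy, zero_mul]
  by_cases hwz : w = z
  · subst hwz
    rw [mul_assoc, hu.col_orth _ _ _ hy.symm, mul_zero]
  by_contra hne'
  refine h y y' x z x' w ?_ ?_ ?_ ?_ ?_
  · simp only [List.nodup_cons, List.mem_cons, List.not_mem_nil, or_false, not_or,
      not_false_eq_true, List.nodup_nil, and_true]
    exact ⟨⟨Ne.symm hz, Ne.symm hxx, Ne.symm hwx⟩, ⟨hzx, Ne.symm hwz⟩, Ne.symm hw⟩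
  · intro h0; simp [h0] at hne
  · intro h0; simp [h0] at hne
  · intro h0; simp [h0] at hne
  · intro h0; simp [h0] at hne'

/-- The coefficients of a magic matrix commute when it is close to being of size `3`. -/
theorem commute_of_no_disjoint_pairs (hu : GraphMagic G H u)
    (h : ∀ y y' x₁ x₂ x₃ x₄, [x₁, x₂, x₃, x₄].Nodup →
      u y x₁ ≠ 0 → u y x₂ ≠ 0 → u y' x₃ ≠ 0 → u y' x₄ ≠ 0 → False)
    (y : W) (x : V) (y' : W) (x' : V) : Commute (u y x) (u y' x') := by
  by_cases hy : y = y'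
  · subst hy
    by_cases hx : x = x'
    · subst hx
      exact Commute.refl _
    · rw [Commute, SemiconjBy, hu.row_orth _ _ _ hx, hu.row_orth _ _ _ (Ne.symm hx)]
  · have h1 := hu.mul_eq_mul_mul h (x := x) (x' := x') hy
    -- In the opposite ring the same identity writes `u y' x' * u y x` as the same palindromic
    -- triple product.
    have h2 := congrArg MulOpposite.unop (hu.op.mul_eq_mul_mul
      (by simpa only [ne_eq, MulOpposite.op_eq_zero_iff] using h) (x := x) (x' := x') hy)
    simp only [MulOpposite.unop_mul, MulOpposite.unop_op] at h2
    rw [Commute, SemiconjBy, h1, h2, mul_assoc]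

/-- Mixing two magic matrices along a commuting idempotent. -/
theorem mix (hu : GraphMagic G H u) {v : W → V → B} (hv : GraphMagic G H v) {p : B}
    (hp : p * p = p) (hpu : ∀ y x, Commute p (u y x)) (hpv : ∀ y x, Commute p (v y x)) :
    GraphMagic G H (fun y x => (1 - p) * u y x + p * v y x) := by
  have hmul : ∀ y x y' x', ((1 - p) * u y x + p * v y x) * ((1 - p) * u y' x' + p * v y' x') =
      (1 - p) * (u y x * u y' x') + p * (v y x * v y' x') := by
    intro y x y' x'
    have h1 : (1 - p) * (1 - p) = 1 - p := by
      rw [mul_sub, mul_one, sub_mul, one_mul, hp, sub_self, sub_zero]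
    have h2 : (1 - p) * p = 0 := by rw [sub_mul, one_mul, hp, sub_self]
    have h3 : p * (1 - p) = 0 := by rw [mul_sub, mul_one, hp, sub_self]
    have hu1 : u y x * (1 - p) = (1 - p) * u y x := by
      rw [mul_sub, sub_mul, mul_one, one_mul, (hpu y x).eq]
    have hu2 : u y x * p = p * u y x := (hpu y x).eq.symm
    have hv1 : v y x * (1 - p) = (1 - p) * v y x := by
      rw [mul_sub, sub_mul, mul_one, one_mul, (hpv y x).eq]
    have hv2 : v y x * p = p * v y x := (hpv y x).eq.symm
    calc _ = (1 - p) * (u y x * (1 - p)) * u y' x' + (1 - p) * (u y x * p) * v y' x' +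
          (p * (v y x * (1 - p)) * u y' x' + p * (v y x * p) * v y' x') := by noncomm_ring
      _ = ((1 - p) * (1 - p)) * u y x * u y' x' + ((1 - p) * p) * u y x * v y' x' +
          ((p * (1 - p)) * v y x * u y' x' + (p * p) * v y x * v y' x') := by
          rw [hu1, hu2, hv1, hv2]
          simp only [mul_assoc]
      _ = _ := by
          rw [h1, h2, h3, hp]
          simp [mul_assoc]
  refine ⟨fun y => ?_, fun x => ?_, fun y x x' h => ?_, fun x y y' h => ?_,
    fun x x' y y' h => ?_⟩
  · rw [Finset.sum_add_distrib, ← Finset.mul_sum, ← Finset.mul_sum, hu.row_sum, hv.row_sum]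
    simp
  · rw [Finset.sum_add_distrib, ← Finset.mul_sum, ← Finset.mul_sum, hu.col_sum, hv.col_sum]
    simp
  · rw [hmul, hu.row_orth _ _ _ h, hv.row_orth _ _ _ h, mul_zero, mul_zero, add_zero]
  · rw [hmul, hu.col_orth _ _ _ h, hv.col_orth _ _ _ h, mul_zero, mul_zero, add_zero]
  · rw [hmul, hu.adj_orth _ _ _ _ h, hv.adj_orth _ _ _ _ h, mul_zero, mul_zero, add_zero]

/-- The product of two magic matrices that act on disjoint sets is magic. -/
theorem mul_of_disjoint [DecidableEq V] {u v : V → V → B} (hu : GraphMagic G G u)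
    (hv : GraphMagic G G v) {S T : Set V} (hST : Disjoint S T)
    (hurow : ∀ y x, y ∉ S → u y x = if y = x then 1 else 0)
    (hucol : ∀ y x, x ∉ S → u y x = if y = x then 1 else 0)
    (hvrow : ∀ y x, y ∉ T → v y x = if y = x then 1 else 0)
    (hvcol : ∀ y x, x ∉ T → v y x = if y = x then 1 else 0) :
    GraphMagic G G (fun y x => ∑ z, u y z * v z x) ∧
      (∀ y x, x ∈ S → ∑ z, u y z * v z x = u y x) ∧
      ∀ y x, x ∈ T → ∑ z, u y z * v z x = v y x := by
  classical
  have hT : ∀ x, x ∈ T → x ∉ S := fun x h h' => Set.disjoint_left.1 hST h' h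
  have r1 : ∀ y x, y ∉ S → ∑ z, u y z * v z x = v y x := fun y x h => by
    simp [hurow y _ h]
  have c1 : ∀ y x, x ∉ T → ∑ z, u y z * v z x = u y x := fun y x h => by
    simp [hvcol _ x h]
  have r2 : ∀ y x, y ∈ S → ∑ z, u y z * v z x = u y x := fun y x h => by
    have : ∀ z, u y z * v z x = u y z * if z = x then 1 else 0 := fun z => by
      by_cases hz : z ∈ T
      · rw [hucol y z (hT z hz), if_neg (by rintro rfl; exact hT _ hz h), zero_mul, zero_mul]
      · rw [hvrow z x hz]
    simp [this]
  have c2 : ∀ y x, x ∈ T → ∑ z, u y z * v z x = v y x := fun y x h => by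
    have : ∀ z, u y z * v z x = (if y = z then 1 else 0) * v z x := fun z => by
      by_cases hz : z ∈ S
      · rw [hvrow z x (fun h' => hT z h' hz), if_neg (by rintro rfl; exact hT _ h hz),
          mul_zero, mul_zero]
      · rw [hucol y z hz]
    simp [this]
  -- Each row and each column of the product coincides with one of `u` or of `v`, which gives sums
  -- and orthogonality; the intertwining relation is preserved by matrix products.
  refine ⟨of_mul_adjMatrix (fun y => ?_) (fun x => ?_) (fun y x x' h => ?_)
    (fun x y y' h => ?_) ?_, fun y x h => c1 y x fun h' => hT x h' h, c2⟩
  · by_cases hy : y ∈ S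
    · simp only [r2 y _ hy, hu.row_sum]
    · simp only [r1 y _ hy, hv.row_sum]
  · by_cases hx : x ∈ T
    · simp only [c2 _ x hx, hv.col_sum]
    · simp only [c1 _ x hx, hu.col_sum]
  · by_cases hy : y ∈ S
    · simp only [r2 y _ hy, hu.row_orth _ _ _ h]
    · simp only [r1 y _ hy, hv.row_orth _ _ _ h]
  · by_cases hx : x ∈ T
    · simp only [c2 _ x hx, hv.col_orth _ _ _ h]
    · simp only [c1 _ x hx, hu.col_orth _ _ _ h]
  · have h : (Matrix.of fun y x => ∑ z, u y z * v z x) = Matrix.of u * Matrix.of v := by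
      ext y x
      simp [Matrix.mul_apply]
    rw [h, Matrix.mul_assoc, hv.mul_adjMatrix, ← Matrix.mul_assoc, hu.mul_adjMatrix,
      Matrix.mul_assoc]

end

section Components

variable {V B : Type} [Fintype V] [Ring B] [Algebra ℂ B] {G : SimpleGraph V} {u : V → V → B}

/-- Rigidity is applied in the corner, whose unit is the block: the entries are `0` or `1` there,
hence `0` or the block in `B`. -/
theorem exists_iso_of_block_ne_zero (hu : GraphMagic G G u) {D C : G.ConnectedComponent}
    (h : block G G u D C ≠ 0) (hr : C.toSimpleGraph.QuantumRigid) :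
    ∃ f : C.toSimpleGraph ≃g D.toSimpleGraph,
      (∀ x, u (f x) x = block G G u D C) ∧ ∀ x y, y ≠ f x → u y x = 0 := by
  have := Corner.nontrivial (hu.block_idem D C) h
  obtain ⟨f, h1, h0⟩ := (hu.cornerBlock_graphMagic D C).exists_iso_of_quantumRigid hr
  exact ⟨f, fun x => congrArg (Corner.val _) (h1 x), fun x y hy => congrArg (Corner.val _) (h0 x y hy)⟩

theorem block_eq_zero_of_rigid (hu : GraphMagic G G u) {D C : G.ConnectedComponent}
    (hr : C.toSimpleGraph.QuantumRigid ∨ D.toSimpleGraph.QuantumRigid)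
    (hDC : ¬ Nonempty (C.toSimpleGraph ≃g D.toSimpleGraph)) : block G G u D C = 0 := by
  by_contra h
  rcases hr with hr | hr
  · obtain ⟨f, -⟩ := hu.exists_iso_of_block_ne_zero h hr
    exact hDC ⟨f⟩
  · rw [← hu.block_symm] at h
    obtain ⟨f, -⟩ := hu.symm.exists_iso_of_block_ne_zero h hr
    exact hDC ⟨f.symm⟩

end Components

end GraphMagic

/-! ### Rigidity and commutativity from the components -/

namespace SimpleGraph

variable {V : Type} [Fintype V] {G : SimpleGraph V}

/-- A graph with rigid and pairwise nonisomorphic components is rigid. -/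
theorem QuantumRigid.of_components (hr : ∀ C : G.ConnectedComponent, C.toSimpleGraph.QuantumRigid)
    (hne : ∀ C D : G.ConnectedComponent, C ≠ D → ¬ Nonempty (C.toSimpleGraph ≃g D.toSimpleGraph)) :
    G.QuantumRigid := by
  intro B _ _ u hu
  have h0 : ∀ D C, D ≠ C → GraphMagic.block G G u D C = 0 := fun D C h =>
    hu.block_eq_zero_of_rigid (Or.inl (hr C)) (hne C D h.symm)
  have h1 := fun C => hr C B _ (hu.of_block_eq_one (hu.block_self_eq_one h0 C))
  refine ⟨fun x => (h1 (G.connectedComponentMk x)).1 ⟨x, rfl⟩, fun x y hxy => ?_⟩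
  by_cases hc : G.connectedComponentMk x = G.connectedComponentMk y
  · exact (h1 (G.connectedComponentMk y)).2 ⟨x, hc⟩ ⟨y, rfl⟩ fun h => hxy (congrArg Subtype.val h)
  · exact hu.eq_zero_of_block (h0 _ _ hc)

/-- A graph with classical, pairwise nonisomorphic components, at most one of which is not rigid,
is classical. -/
theorem QuantumClassical.of_components
    (hcl : ∀ C : G.ConnectedComponent, C.toSimpleGraph.QuantumClassical)
    (hr : ∀ C D : G.ConnectedComponent, C ≠ D →
      C.toSimpleGraph.QuantumRigid ∨ D.toSimpleGraph.QuantumRigid)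
    (hne : ∀ C D : G.ConnectedComponent, C ≠ D → ¬ Nonempty (C.toSimpleGraph ≃g D.toSimpleGraph)) :
    G.QuantumClassical := by
  intro B _ _ u hu
  have h0 : ∀ D C, D ≠ C → GraphMagic.block G G u D C = 0 := fun D C h =>
    hu.block_eq_zero_of_rigid (hr C D h.symm) (hne C D h.symm)
  have h1 := fun C => hu.of_block_eq_one (hu.block_self_eq_one h0 C)
  have hz : ∀ x y, G.connectedComponentMk x ≠ G.connectedComponentMk y → u x y = 0 :=
    fun x y h => hu.eq_zero_of_block (h0 _ _ h)
  -- On a rigid component the diagonal block is the identity matrix, so its entries are central;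
  -- only entries within one common component need `hcl`.
  have hrigid : ∀ x y, G.connectedComponentMk x = G.connectedComponentMk y →
      (G.connectedComponentMk y).toSimpleGraph.QuantumRigid → ∀ b, Commute (u x y) b := by
    intro x y hxy hr b
    obtain ⟨h2, h3⟩ := hr B _ (h1 _)
    by_cases h : x = y
    · subst h
      rw [h2 ⟨x, rfl⟩]
      exact Commute.one_left _
    · rw [h3 ⟨x, hxy⟩ ⟨y, rfl⟩ fun h' => h (congrArg Subtype.val h')]
      exact Commute.zero_left _
  intro x y x' y'
  by_cases h : G.connectedComponentMk x = G.connectedComponentMk y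
  swap
  · rw [hz _ _ h]
    exact Commute.zero_left _
  by_cases h' : G.connectedComponentMk x' = G.connectedComponentMk y'
  swap
  · rw [hz _ _ h']
    exact Commute.zero_right _
  by_cases hy : G.connectedComponentMk y' = G.connectedComponentMk y
  · exact hcl (G.connectedComponentMk y) B _ (h1 _) ⟨x, h⟩ ⟨y, rfl⟩ ⟨x', h'.trans hy⟩ ⟨y', hy⟩
  · rcases hr _ _ hy with hr | hr
    · exact (hrigid _ _ h' hr _).symm
    · exact hrigid _ _ h hr _

/-- A graph with rigid components, without two disjoint pairs of isomorphic components, is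
classical. -/
theorem QuantumClassical.of_rigid_components
    (hr : ∀ C : G.ConnectedComponent, C.toSimpleGraph.QuantumRigid)
    (h4 : ∀ C₁ C₂ C₃ C₄ : G.ConnectedComponent, [C₁, C₂, C₃, C₄].Nodup →
      Nonempty (C₁.toSimpleGraph ≃g C₂.toSimpleGraph) →
      Nonempty (C₃.toSimpleGraph ≃g C₄.toSimpleGraph) → False) :
    G.QuantumClassical := by
  intro B _ _ u hu
  have hiso : ∀ D C, GraphMagic.block G G u D C ≠ 0 →
      Nonempty (C.toSimpleGraph ≃g D.toSimpleGraph) := fun D C h => by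
    by_contra h'
    exact h (hu.block_eq_zero_of_rigid (Or.inl (hr C)) h')
  -- Two nonzero blocks in the same row give two components isomorphic to a third, hence to each
  -- other; four such components would contradict `h4`.
  have hcomm := hu.block_graphMagic.commute_of_no_disjoint_pairs
    fun D D' C₁ C₂ C₃ C₄ hn h1 h2 h3 h4' => by
      obtain ⟨f₁⟩ := hiso _ _ h1
      obtain ⟨f₂⟩ := hiso _ _ h2
      obtain ⟨f₃⟩ := hiso _ _ h3
      obtain ⟨f₄⟩ := hiso _ _ h4'
      exact h4 C₁ C₂ C₃ C₄ hn ⟨f₁.trans f₂.symm⟩ ⟨f₃.trans f₄.symm⟩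
  have hval : ∀ x y, u x y = 0 ∨ u x y = GraphMagic.block G G u (G.connectedComponentMk x)
      (G.connectedComponentMk y) := by
    intro x y
    by_cases h : GraphMagic.block G G u (G.connectedComponentMk x) (G.connectedComponentMk y) = 0
    · exact Or.inl (hu.eq_zero_of_block h)
    · obtain ⟨f, hf1, hf0⟩ := hu.exists_iso_of_block_ne_zero h (hr _)
      by_cases hxy : (⟨x, rfl⟩ : G.connectedComponentMk x) = f ⟨y, rfl⟩
      · right
        rw [← hf1 ⟨y, rfl⟩, ← hxy]
      · exact Or.inl (hf0 ⟨y, rfl⟩ ⟨x, rfl⟩ hxy)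
  intro x y x' y'
  rcases hval x y with h | h <;> rw [h]
  · exact Commute.zero_left _
  rcases hval x' y' with h' | h' <;> rw [h']
  · exact Commute.zero_right _
  exact hcomm _ _ _ _

end SimpleGraph

/-! ### Asymmetry and Schmidt's criterion through components and complements -/

namespace SimpleGraph

variable {V : Type*} {G : SimpleGraph V}

theorem subsingleton_aut_iff : Subsingleton (G ≃g G) ↔ ∀ (f : G ≃g G) x, f x = x :=
  ⟨fun _ f x => by rw [Subsingleton.elim f (RelIso.refl _)]; rfl,
    fun h => ⟨fun f g => by ext x; rw [h f, h g]⟩⟩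

theorem QuantumRigid.subsingleton_aut {V : Type} [Fintype V] {G : SimpleGraph V}
    (h : G.QuantumRigid) : Subsingleton (G ≃g G) := by
  classical
  rw [subsingleton_aut_iff]
  intro f x
  have := (h ℂ _ (GraphMagic.ofIso f)).1 x
  by_contra hx
  simp [Ne.symm hx] at this

theorem subsingleton_aut_component (h : Subsingleton (G ≃g G)) (C : G.ConnectedComponent) :
    Subsingleton (C.toSimpleGraph ≃g C.toSimpleGraph) := by
  rw [subsingleton_aut_iff] at h ⊢
  intro φ x
  obtain ⟨f, hf, -⟩ := exists_aut_of_component_aut φ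
  exact Subtype.ext ((hf x).symm.trans (h f x))

/-- Exchanging two isomorphic components would be a nontrivial automorphism. -/
theorem not_iso_component (h : Subsingleton (G ≃g G)) {C D : G.ConnectedComponent}
    (hCD : C ≠ D) : ¬ Nonempty (C.toSimpleGraph ≃g D.toSimpleGraph) := by
  rintro ⟨φ⟩
  rw [subsingleton_aut_iff] at h
  obtain ⟨f, hf, -⟩ := exists_aut_of_component_iso φ
  obtain ⟨x, hx⟩ := C.nonempty_supp
  have h1 : G.connectedComponentMk (φ ⟨x, hx⟩) = D := (φ ⟨x, hx⟩).2
  rw [← hf, h] at h1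
  exact hCD (Eq.trans (Eq.symm hx) h1)

theorem subsingleton_aut_compl_iff : Subsingleton (Gᶜ ≃g Gᶜ) ↔ Subsingleton (G ≃g G) := by
  simp only [subsingleton_aut_iff]
  refine ⟨fun h f x => h f.complement x, fun h f x => ?_⟩
  have h' : ∀ (K : SimpleGraph V), K = G → ∀ (g : K ≃g K) x, g x = x := by
    rintro K rfl
    exact h
  exact h' _ (_root_.compl_compl G) f.complement x

end SimpleGraph

namespace FinGraph

variable {G : FinGraph}

theorem SchmidtCriterion.of_compl (h : G.compl.SchmidtCriterion) : G.SchmidtCriterion := by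
  have h' : ∀ K : FinGraph, K = G.compl.compl → K.SchmidtCriterion := by
    rintro K rfl
    obtain ⟨f, g, hf, hg, hd⟩ := h
    exact ⟨f.complement, g.complement, hf, hg, hd⟩
  exact h' G G.compl_compl.symm

theorem SchmidtCriterion.of_component {C : G.graph.ConnectedComponent}
    (h : (G.component C).SchmidtCriterion) : G.SchmidtCriterion := by
  obtain ⟨φ, ψ, ⟨x, hx⟩, ⟨y, hy⟩, hd⟩ := h
  obtain ⟨f, hf, hf'⟩ := SimpleGraph.exists_aut_of_component_aut (C := C) φ
  obtain ⟨g, hg, hg'⟩ := SimpleGraph.exists_aut_of_component_aut (C := C) ψ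
  refine ⟨f, g, ⟨_, fun h => hx (Subtype.ext ((hf x).symm.trans h))⟩,
    ⟨_, fun h => hy (Subtype.ext ((hg y).symm.trans h))⟩, ?_⟩
  rw [Set.disjoint_left] at hd ⊢
  intro z h1 h2
  have hz : G.graph.connectedComponentMk z = C := by
    by_contra h
    exact h1 (hf' z h)
  exact hd (a := (⟨z, hz⟩ : C)) (fun h => h1 ((hf ⟨z, hz⟩).trans (congrArg Subtype.val h)))
    (fun h => h2 ((hg ⟨z, hz⟩).trans (congrArg Subtype.val h)))

/-- Schmidt's criterion holds if two disjoint pairs of components are related by isomorphisms that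
move some vertex. -/
theorem SchmidtCriterion.of_component_isos {C D C' D' : G.graph.ConnectedComponent}
    (φ : C.toSimpleGraph ≃g D.toSimpleGraph) (ψ : C'.toSimpleGraph ≃g D'.toSimpleGraph)
    (hφ : ∃ x, (φ x : G.V) ≠ x) (hψ : ∃ x, (ψ x : G.V) ≠ x) (h1 : C ≠ C') (h2 : C ≠ D')
    (h3 : D ≠ C') (h4 : D ≠ D') : G.SchmidtCriterion := by
  obtain ⟨x, hx⟩ := hφ
  obtain ⟨y, hy⟩ := hψ
  obtain ⟨f, hf, hf'⟩ := SimpleGraph.exists_aut_of_component_iso φ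
  obtain ⟨g, hg, hg'⟩ := SimpleGraph.exists_aut_of_component_iso ψ
  refine ⟨f, g, ⟨_, by rwa [← hf] at hx⟩, ⟨_, by rwa [← hg] at hy⟩, ?_⟩
  rw [Set.disjoint_left]
  intro z hz1 hz2
  have h5 : G.graph.connectedComponentMk z = C ∨ G.graph.connectedComponentMk z = D := by
    by_contra! h
    exact hz1 (hf' z h.1 h.2)
  have h6 : G.graph.connectedComponentMk z = C' ∨ G.graph.connectedComponentMk z = D' := by
    by_contra! h
    exact hz2 (hg' z h.1 h.2)
  rcases h5 with h5 | h5 <;> rcases h6 with h6 | h6 <;> rw [h5] at h6 <;> contradiction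

theorem exists_moved_of_ne {C D : G.graph.ConnectedComponent}
    (φ : C.toSimpleGraph ≃g D.toSimpleGraph) (h : C ≠ D) : ∃ x, (φ x : G.V) ≠ x := by
  obtain ⟨x, hx⟩ := C.nonempty_supp
  refine ⟨⟨x, hx⟩, fun h' => h ?_⟩
  have h1 : G.graph.connectedComponentMk (φ ⟨x, hx⟩) = D := (φ ⟨x, hx⟩).2
  rw [h'] at h1
  exact Eq.trans (Eq.symm hx) h1

theorem exists_moved_of_not_subsingleton {C : G.graph.ConnectedComponent}
    (h : ¬ Subsingleton (C.toSimpleGraph ≃g C.toSimpleGraph)) :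
    ∃ (φ : C.toSimpleGraph ≃g C.toSimpleGraph) (x : C), (φ x : G.V) ≠ x := by
  rw [SimpleGraph.subsingleton_aut_iff] at h
  push Not at h
  obtain ⟨φ, x, h⟩ := h
  exact ⟨φ, x, fun h' => h (Subtype.ext h')⟩

/-- Nontrivial automorphisms of two distinct components, extended by the identity, have disjoint
supports. -/
theorem subsingleton_aut_or (hS : ¬ G.SchmidtCriterion) {C D : G.graph.ConnectedComponent}
    (h : C ≠ D) : Subsingleton (C.toSimpleGraph ≃g C.toSimpleGraph) ∨
      Subsingleton (D.toSimpleGraph ≃g D.toSimpleGraph) := by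
  by_contra! h'
  obtain ⟨φ, hφ⟩ := exists_moved_of_not_subsingleton (not_subsingleton_iff_nontrivial.2 h'.1)
  obtain ⟨ψ, hψ⟩ := exists_moved_of_not_subsingleton (not_subsingleton_iff_nontrivial.2 h'.2)
  exact hS (.of_component_isos φ ψ hφ hψ h h h h)

/-- The exchange of `C` and `D` and a nontrivial automorphism of a third component would be
disjointly supported. For `C` and `D` themselves, one is asymmetric by `subsingleton_aut_or`, and
then so is the other, being isomorphic to it. -/
theorem subsingleton_aut_of_iso (hS : ¬ G.SchmidtCriterion) {C D : G.graph.ConnectedComponent}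
    (h : C ≠ D) (φ : C.toSimpleGraph ≃g D.toSimpleGraph) (E : G.graph.ConnectedComponent) :
    Subsingleton (E.toSimpleGraph ≃g E.toSimpleGraph) := by
  have hiso : Subsingleton (C.toSimpleGraph ≃g C.toSimpleGraph) ↔
      Subsingleton (D.toSimpleGraph ≃g D.toSimpleGraph) := by
    simp only [SimpleGraph.subsingleton_aut_iff]
    exact ⟨fun h f x => by simpa using congrArg φ (h ((φ.trans f).trans φ.symm) (φ.symm x)),
      fun h f x => by simpa using congrArg φ.symm (h ((φ.symm.trans f).trans φ) (φ x))⟩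
  have h' := subsingleton_aut_or hS h
  by_cases hC : E = C
  · subst hC
    exact h'.elim id hiso.2
  by_cases hD : E = D
  · subst hD
    exact h'.elim hiso.1 id
  by_contra hE
  obtain ⟨ψ, hψ⟩ := exists_moved_of_not_subsingleton hE
  exact hS (.of_component_isos φ ψ (exists_moved_of_ne φ h) hψ (Ne.symm hC) (Ne.symm hC)
    (Ne.symm hD) (Ne.symm hD))

/-- Schmidt's criterion implies quantum symmetry. -/
theorem SchmidtCriterion.quantumSymmetry (h : G.SchmidtCriterion) : G.QuantumSymmetry := by
  classical
  rw [quantumSymmetry_iff]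
  intro hcl
  obtain ⟨f, g, ⟨a, ha⟩, ⟨b, hb⟩, hd⟩ := h
  -- Any two noncommuting idempotents serve; `q` is not self-adjoint, which is harmless because
  -- `QuantumClassical` involves no involution.
  let p : Matrix (Fin 2) (Fin 2) ℂ := !![1, 0; 0, 0]
  let q : Matrix (Fin 2) (Fin 2) ℂ := !![1, 1; 0, 0]
  have hp : p * p = p := by
    ext i j
    fin_cases i <;> fin_cases j <;> simp [p, Matrix.mul_apply]
  have hq : q * q = q := by
    ext i j
    fin_cases i <;> fin_cases j <;> simp [q, Matrix.mul_apply]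
  have hpq : ¬ Commute p q := fun h => by
    have := congrFun (congrFun h.eq 0) 1
    simp [p, q] at this
  have hδ := GraphMagic.ofIso (B := Matrix (Fin 2) (Fin 2) ℂ) (RelIso.refl _ : G.graph ≃g G.graph)
  have hcomm : ∀ (r : Matrix (Fin 2) (Fin 2) ℂ) (c : Prop) [Decidable c],
      Commute r (if c then 1 else 0) := fun r c _ => by
    split_ifs
    · exact Commute.one_right _
    · exact Commute.zero_right _
  have hu := hδ.mix (GraphMagic.ofIso f) hp (fun _ _ => hcomm _ _) (fun _ _ => hcomm _ _)
  have hv := hδ.mix (GraphMagic.ofIso g) hq (fun _ _ => hcomm _ _) (fun _ _ => hcomm _ _)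
  have hfix : ∀ (k : G.graph ≃g G.graph) (r : Matrix (Fin 2) (Fin 2) ℂ) (y x : G.V),
      (y ∉ {x | k x ≠ x} ∨ x ∉ {x | k x ≠ x}) →
      (1 - r) * (if y = (RelIso.refl G.graph.Adj) x then 1 else 0) +
        r * (if y = k x then 1 else 0) = if y = x then 1 else 0 := by
    intro k r y x hk
    have h1 : y = k x ↔ y = x := by
      simp only [Set.mem_ofPred_eq, not_not] at hk
      rcases hk with hk | hk
      · refine ⟨fun h => k.injective (hk.trans h), ?_⟩
        rintro rfl
        exact hk.symm
      · rw [hk]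
    simp only [h1, RelIso.refl_apply]
    split_ifs <;> simp
  obtain ⟨hw, hw1, hw2⟩ := hu.mul_of_disjoint hv hd
    (fun y x h => hfix f p y x (Or.inl h)) (fun y x h => hfix f p y x (Or.inr h))
    (fun y x h => hfix g q y x (Or.inl h)) (fun y x h => hfix g q y x (Or.inr h))
  refine hpq ?_
  -- As `f a ≠ a` and `g b ≠ b`, these two entries of the product matrix are exactly `p` and `q`.
  have := hcl _ _ hw (f a) a (g b) b
  rw [hw1 _ _ ha, hw2 _ _ hb] at this
  simpa [ha, hb] using this

end FinGraph

/-! ### The axioms (QA) and (SA) for F-cographs -/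

namespace GraphClass

variable {F : GraphClass}

theorem QA.co (hcompl : F.StableCompl) (hcomp : F.StableComponents) (hQA : F.QA) :
    F.co.QA := by
  have key : ∀ n, ∀ G : FinGraph, F.InCo G → Fintype.card G.V = n →
      Subsingleton (G.graph ≃g G.graph) → G.graph.QuantumRigid := by
    intro n
    induction n using Nat.strong_induction_on with
    | _ n ih =>
      have step : ∀ G : FinGraph, F.InCo G → Fintype.card G.V = n → ¬ G.graph.Preconnected →
          Subsingleton (G.graph ≃g G.graph) → G.graph.QuantumRigid := by
        intro G hG hn hp hA
        refine .of_components (fun C => ?_) (fun C D hCD => SimpleGraph.not_iso_component hA hCD)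
        exact ih _ (hn ▸ SimpleGraph.card_component_lt hp C) (G.component C)
          ((hG.components hcompl hcomp).1 C) rfl (SimpleGraph.subsingleton_aut_component hA C)
      intro G hG hn hA
      rcases hG.mem_or_not_preconnected hcompl with h | h | h
      · exact G.trivialQu_iff.1 ((hQA G h).2 hA)
      · exact step G hG hn h hA
      · have : G.graphᶜᶜ.QuantumRigid := (step _ hG.compl hn h
          (SimpleGraph.subsingleton_aut_compl_iff.2 hA)).compl
        rwa [_root_.compl_compl] at this
  refine fun G hG => ⟨fun h => (G.trivialQu_iff.1 h).subsingleton_aut, fun h => ?_⟩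
  exact G.trivialQu_iff.2 (key _ G hG rfl h)

theorem SA.co (hcompl : F.StableCompl) (hcomp : F.StableComponents) (hQA : F.QA) (hSA : F.SA) :
    F.co.SA := by
  have key : ∀ n, ∀ G : FinGraph, F.InCo G → Fintype.card G.V = n →
      ¬ G.SchmidtCriterion → G.graph.QuantumClassical := by
    intro n
    induction n using Nat.strong_induction_on with
    | _ n ih =>
      have step : ∀ G : FinGraph, F.InCo G → Fintype.card G.V = n → ¬ G.graph.Preconnected →
          ¬ G.SchmidtCriterion → G.graph.QuantumClassical := by
        intro G hG hn hp hS
        have hrigid : ∀ C : G.graph.ConnectedComponent,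
            Subsingleton (C.toSimpleGraph ≃g C.toSimpleGraph) → C.toSimpleGraph.QuantumRigid :=
          fun C hC => (G.component C).trivialQu_iff.1
            ((hQA.co hcompl hcomp (G.component C) ((hG.components hcompl hcomp).1 C)).2 hC)
        -- Without isomorphic components the failure of Schmidt's criterion leaves at most one
        -- component not rigid. With an isomorphic pair it makes all components rigid and excludes a
        -- second disjoint pair.
        by_cases hne : ∀ C D : G.graph.ConnectedComponent, C ≠ D →
            ¬ Nonempty (C.toSimpleGraph ≃g D.toSimpleGraph)
        · refine .of_components (fun C => ?_) (fun C D hCD => ?_) hne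
          · exact ih _ (hn ▸ SimpleGraph.card_component_lt hp C) (G.component C)
              ((hG.components hcompl hcomp).1 C) rfl (mt .of_component hS)
          · exact (FinGraph.subsingleton_aut_or hS hCD).imp (hrigid C) (hrigid D)
        · push Not at hne
          obtain ⟨C, D, hCD, ⟨φ⟩⟩ := hne
          refine .of_rigid_components
            (fun E => hrigid E (FinGraph.subsingleton_aut_of_iso hS hCD φ E)) ?_
          rintro C₁ C₂ C₃ C₄ hn ⟨ψ⟩ ⟨χ⟩
          simp only [List.nodup_cons, List.mem_cons, List.not_mem_nil, or_false, not_or,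
            not_false_eq_true, List.nodup_nil, and_true] at hn
          obtain ⟨⟨h12, h13, h14⟩, ⟨h23, h24⟩, h34⟩ := hn
          exact hS (.of_component_isos ψ χ (FinGraph.exists_moved_of_ne ψ h12)
            (FinGraph.exists_moved_of_ne χ h34) h13 h14 h23 h24)
      intro G hG hn hS
      rcases hG.mem_or_not_preconnected hcompl with h | h | h
      · by_contra hc
        exact hS ((hSA G h).1 (G.quantumSymmetry_iff.2 hc))
      · exact step G hG hn h hS
      · have : G.graphᶜᶜ.QuantumClassical := (step _ hG.compl hn h
          (mt .of_compl hS)).compl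
        rwa [_root_.compl_compl] at this
  refine fun G hG => ⟨fun h => ?_, fun h => h.quantumSymmetry⟩
  by_contra hS
  exact G.quantumSymmetry_iff.1 h (key _ G hG rfl hS)

end GraphClass

end

theorem mainTheorem7 (F : GraphClass) (hcompl : F.StableCompl) (hcomp : F.StableComponents) :
    (F.QI → F.co.QI) ∧
    (F.QI ∧ F.QA → F.co.QI ∧ F.co.QA) ∧
    (F.QI ∧ F.QA ∧ F.SA → F.co.QI ∧ F.co.QA ∧ F.co.SA) :=
  ⟨fun h => h.co hcompl hcomp, fun h => ⟨h.1.co hcompl hcomp, h.2.co hcompl hcomp⟩,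
    fun h => ⟨h.1.co hcompl hcomp, h.2.1.co hcompl hcomp, h.2.2.co hcompl hcomp h.2.1⟩⟩
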